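/- Let $V=\mathbb R^N$ with its standard inner product, let $G\subset O(N)$ be a Lie subgroup with Lie algebra $\mathfrak g\subset \mathrm{End}(V)=V^*\otimes V$, and let $M$ be a smooth manifold of dimension $N$. Put $\mathfrak g^0=\{0\}$ and, for $k\ge 1$, let $\mathfrak g^k\subset\Lambda^kV^*\otimes V$ be the span of all $\sum_{i,j}(\alpha\wedge a_i^jv^i)\otimes v_j$ with $\alpha\in\Lambda^{k-1}V^*$ and $\sum_{i,j}a_i^jv^i\otimes v_j\in\mathfrak g$, where $(v_i)$ is a basis of $V$ with dual basis $(v^i)$ (so $\mathfrak g^1=\mathfrak g$); let $P^k$ be the orthogonal complement of $\mathfrak g^k$ in $\Lambda^kV^*\otimes V$. Let $Q$ be a $G$-structure on $M$ with principal $G$-bundle of adapted frames $\widetilde Q$ and induced Riemannian metric $g_Q$, and let $\hat{\mathfrak g}^k_Q=\widetilde Q\times_G\mathfrak g^k$ and $\hat P^k_Q=\widetilde Q\times_GP^k$ be the associated subbundles of $\Lambda^kT^*M\otimes TM$. Suppose that $Q$ is torsion-free, that is, the Levi-Civita connection $\nabla$ of $g_Q$ reduces to a connection on $\widetilde Q$.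 Let $d^\nabla_k:\Gamma(\Lambda^kT^*M\otimes TM)\to\Gamma(\Lambda^{k+1}T^*M\otimes TM)$ be the covariant exterior derivative of $\nabla$, and let $d^Q_k=\mathrm{pr}_{\hat P^{k+1}_Q}\circ d^\nabla_k$, where $\mathrm{pr}$ is the fibrewise orthogonal projection. Then for every $k\ge 0$: 1. $d^\nabla_{k+1}\circ d^\nabla_k$ maps $\Gamma(\Lambda^kT^*M\otimes TM)$ into $\Gamma(\hat{\mathfrak g}^{k+2}_Q)$; 2. $d^Q_k$ maps $\Gamma(\hat P^k_Q)$ into $\Gamma(\hat P^{k+1}_Q)$, and $d^Q_{k+1}\circ d^Q_k=0$ on $\Gamma(\hat P^k_Q)$, so that the operators $d^Q_k$ form a complex. -/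

import Mathlib

open Bundle
open scoped Manifold ContDiff Topology

noncomputable section

namespace GStr

/-- The model space `V = ℝ^N` with its standard inner product. -/
abbrev Eu (N : ℕ) : Type := EuclideanSpace ℝ (Fin N)

/-- The space `Λ^k V^* ⊗ V`, seen as the space of alternating `k`-linear maps `V^k → V`. -/
abbrev VForm (N k : ℕ) : Type := Eu N [⋀^Fin k]→L[ℝ] Eu N

/-! ### Linear algebra on the model space -/

/-- The Lie algebra of a subgroup `G` of `O(N)`, inside `End V`: the velocities at time `0` of the
smooth curves in `End V` that stay in `G` and start at the identity. -/
def lieAlg {N : ℕ} (G : Subgroup (Eu N ≃ₗᵢ[ℝ] Eu N)) : Submodule ℝ (Eu N →L[ℝ] Eu N) where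
  carrier := {A | ∃ c : ℝ → (Eu N →L[ℝ] Eu N), ContDiff ℝ ∞ c ∧
    (∀ t, ∃ g ∈ G, ∀ w, c t w = g w) ∧ c 0 = ContinuousLinearMap.id ℝ (Eu N) ∧ HasDerivAt c A 0}
  zero_mem' := ⟨fun _ => ContinuousLinearMap.id ℝ (Eu N), contDiff_const,
    fun _ => ⟨1, G.one_mem, fun _ => rfl⟩, rfl, hasDerivAt_const _ _⟩
  add_mem' := by
    rintro A B ⟨c, hc, hcG, hc0, hcA⟩ ⟨d, hd, hdG, hd0, hdB⟩
    refine ⟨fun t => (c t).comp (d t), hc.clm_comp hd, fun t => ?_, ?_, ?_⟩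
    · obtain ⟨g, hg, hgc⟩ := hcG t
      obtain ⟨h, hh, hhd⟩ := hdG t
      exact ⟨g * h, G.mul_mem hg hh, fun w => by simp [hgc, hhd]⟩
    · ext w
      simp [hc0, hd0]
    · have h := hcA.clm_comp hdB
      simpa [hc0, hd0] using h
  smul_mem' := by
    rintro a A ⟨c, hc, hcG, hc0, hcA⟩
    refine ⟨fun t => c (a * t), hc.comp (contDiff_const.mul contDiff_id), fun t => hcG _,
      by simpa using hc0, ?_⟩
    have h1 : HasDerivAt (fun t : ℝ => a * t) a 0 := by
      simpa using (hasDerivAt_id (0 : ℝ)).const_mul a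
    have h2 : HasDerivAt c A (a * 0) := by simpa using hcA
    exact h2.scomp (0 : ℝ) h1

/-- The product `α ∧ A` in `Λ^{k+1} V^* ⊗ V` of `α ∈ Λ^k V^*` and `A ∈ End V = V^* ⊗ V`; for
`A = ∑ a_i^j v^i ⊗ v_j` it is `∑ (α ∧ a_i^j v^i) ⊗ v_j`. -/
def wedge {N k : ℕ} (α : Eu N [⋀^Fin k]→L[ℝ] ℝ) (A : Eu N →L[ℝ] Eu N) : VForm N (k + 1) :=
  (-1 : ℝ) ^ k • ContinuousAlternatingMap.alternatizeUncurryFin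
    ((ContinuousLinearMap.compContinuousAlternatingMapCLM (ι := Fin k) ℝ (Eu N) ℝ (Eu N)).flip α ∘L
      (ContinuousLinearMap.toSpanSingletonCLE (𝕜 := ℝ) (E := Eu N) :
        Eu N →L[ℝ] (ℝ →L[ℝ] Eu N)) ∘L A)

theorem wedge_apply {N k : ℕ} (α : Eu N [⋀^Fin k]→L[ℝ] ℝ) (A : Eu N →L[ℝ] Eu N)
    (w : Fin (k + 1) → Eu N) :
    wedge α A w = (-1 : ℝ) ^ k • ∑ i : Fin (k + 1), (-1 : ℝ) ^ (i : ℕ) • α (i.removeNth w) • A (w i) := by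
  simp only [wedge, ContinuousAlternatingMap.smul_apply,
    ContinuousAlternatingMap.alternatizeUncurryFin_apply]
  congr 1
  refine Finset.sum_congr rfl fun i _ => ?_
  rcases Nat.even_or_odd (i : ℕ) with h | h <;> simp [h.neg_one_pow]

/-- The subspace `𝔤^k` of `Λ^k V^* ⊗ V`: it is `0` for `k = 0` and the span of all `α ∧ A` with
`α ∈ Λ^{k-1} V^*` and `A ∈ 𝔤` for `k ≥ 1` (which is `𝔤` itself for `k = 1`). -/
def gPow {N : ℕ} (G : Subgroup (Eu N ≃ₗᵢ[ℝ] Eu N)) : (k : ℕ) → Submodule ℝ (VForm N k)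
  | 0 => ⊥
  | _ + 1 => Submodule.span ℝ {B | ∃ α, ∃ A ∈ lieAlg G, B = wedge α A}

/-- The inner product on `Λ^k V^* ⊗ V` induced by that of `V` (up to the factor `k!`). -/
def formInner (N k : ℕ) : LinearMap.BilinForm ℝ (VForm N k) :=
  LinearMap.mk₂ ℝ
    (fun a b => ∑ I : Fin k → Fin N, inner ℝ (a fun j => EuclideanSpace.single (I j) (1 : ℝ))
      (b fun j => EuclideanSpace.single (I j) (1 : ℝ)))
    (fun a a' b => by simp [inner_add_left, Finset.sum_add_distrib])
    (fun c a b => by simp [real_inner_smul_left, Finset.mul_sum])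
    (fun a b b' => by simp [inner_add_right, Finset.sum_add_distrib])
    (fun c a b => by simp [real_inner_smul_right, Finset.mul_sum])

/-- The orthogonal complement `P^k` of `𝔤^k` in `Λ^k V^* ⊗ V`. -/
def pPow {N : ℕ} (G : Subgroup (Eu N ≃ₗᵢ[ℝ] Eu N)) (k : ℕ) : Submodule ℝ (VForm N k) :=
  (formInner N k).orthogonal (gPow G k)

theorem formInner_self_eq_zero {N k : ℕ} {a : VForm N k} (h : formInner N k a a = 0) : a = 0 := by
  have h' : ∀ I : Fin k → Fin N, a (fun j => EuclideanSpace.single (I j) (1 : ℝ)) = 0 := by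
    intro I
    have := (Finset.sum_eq_zero_iff_of_nonneg (fun I _ => real_inner_self_nonneg)).1 h I
      (Finset.mem_univ I)
    exact inner_self_eq_zero.1 this
  refine ContinuousAlternatingMap.toAlternatingMap_injective
    ((EuclideanSpace.basisFun (Fin N) ℝ).toBasis.ext_alternating fun I _ => ?_)
  simpa using h' I

theorem isCompl_pPow {N : ℕ} (G : Subgroup (Eu N ≃ₗᵢ[ℝ] Eu N)) (k : ℕ) :
    IsCompl (pPow G k) (gPow G k) := by
  have hrefl : (formInner N k).IsRefl := by
    intro a b h
    rw [← h]
    exact Finset.sum_congr rfl fun I _ => real_inner_comm _ _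
  have : FiniteDimensional ℝ (VForm N k) := by
    refine FiniteDimensional.of_injective (V₂ := (Fin k → Fin N) → Eu N)
      { toFun := fun a I => a fun j => EuclideanSpace.single (I j) (1 : ℝ)
        map_add' := fun a b => rfl
        map_smul' := fun c a => rfl } ?_
    rw [← LinearMap.ker_eq_bot, LinearMap.ker_eq_bot']
    intro a ha
    refine formInner_self_eq_zero (Finset.sum_eq_zero fun I _ => ?_)
    rw [show (a fun j => EuclideanSpace.single (I j) (1 : ℝ)) = 0 from congrFun ha I]
    exact inner_zero_left _
  refine (LinearMap.BilinForm.isCompl_orthogonal_of_restrict_nondegenerate hrefl ?_).symm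
  refine ⟨fun a ha => ?_, fun a ha => ?_⟩
  · exact Subtype.ext (formInner_self_eq_zero (ha a))
  · exact Subtype.ext (formInner_self_eq_zero (ha a))

/-- The orthogonal projection of `Λ^k V^* ⊗ V` onto `P^k`. -/
def prP {N : ℕ} (G : Subgroup (Eu N ≃ₗᵢ[ℝ] Eu N)) (k : ℕ) : VForm N k →ₗ[ℝ] VForm N k :=
  (pPow G k).projection (gPow G k) (isCompl_pPow G k)

/-! ### Manifolds -/

variable {N : ℕ} {M : Type*} [TopologicalSpace M] [ChartedSpace (Eu N) M]
  [IsManifold (𝓡 N) ∞ M]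

/-- A frame at `x`: a linear isomorphism `V ≃ T_x M`. -/
abbrev Frame (x : M) : Type := Eu N ≃L[ℝ] TangentSpace (𝓡 N) x

/-- The fibre of `Λ^k T^*M ⊗ TM` at `x`: alternating `k`-linear maps `(T_x M)^k → T_x M`. -/
abbrev TForm (k : ℕ) (x : M) : Type :=
  TangentSpace (𝓡 N) x [⋀^Fin k]→L[ℝ] TangentSpace (𝓡 N) x

/-- The isomorphism `Λ^k V^* ⊗ V ≃ Λ^k T_x^*M ⊗ T_x M` induced by a frame. -/
def Frame.push {x : M} (u : Frame (N := N) x) {k : ℕ} (a : VForm N k) : TForm (N := N) k x :=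
  (u : Eu N →L[ℝ] TangentSpace (𝓡 N) x).compContinuousAlternatingMap
    (a.compContinuousLinearMap (u.symm : TangentSpace (𝓡 N) x →L[ℝ] Eu N))

/-- The inverse of `Frame.push`. -/
def Frame.pull {x : M} (u : Frame (N := N) x) {k : ℕ} (b : TForm (N := N) k x) : VForm N k :=
  (u.symm : TangentSpace (𝓡 N) x →L[ℝ] Eu N).compContinuousAlternatingMap
    (b.compContinuousLinearMap (u : Eu N →L[ℝ] TangentSpace (𝓡 N) x))

/-- The family `s` of frames is smooth on `U` (a smooth local section of the frame bundle). -/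
def SmoothFramesOn (s : ∀ x : M, Frame (N := N) x) (U : Set M) : Prop :=
  ∀ w : Eu N, ContMDiffOn (𝓡 N) (𝓡 N).tangent ∞
    (fun x => (⟨x, s x w⟩ : TangentBundle (𝓡 N) M)) U

/-- A `G`-structure on `M`, given by its principal `G`-bundle of adapted frames: every fibre is
an orbit of `G` acting on the frames on the right, and there are smooth local sections. -/
structure GStructure (G : Subgroup (Eu N ≃ₗᵢ[ℝ] Eu N)) (M : Type*) [TopologicalSpace M]
    [ChartedSpace (Eu N) M] [IsManifold (𝓡 N) ∞ M] where
  frames : ∀ x : M, Set (Frame (N := N) x)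
  nonempty : ∀ x, (frames x).Nonempty
  orbit : ∀ x, ∀ u ∈ frames x, ∀ u' : Frame (N := N) x,
    u' ∈ frames x ↔ ∃ g ∈ G, ∀ w, u' w = u (g w)
  smooth : ∀ x : M, ∃ U : Set M, IsOpen U ∧ x ∈ U ∧ ∃ s : ∀ y : M, Frame (N := N) y,
    (∀ y ∈ U, s y ∈ frames y) ∧ SmoothFramesOn s U

/-- A section of `Λ^k T^*M ⊗ TM` is smooth, i.e. it is an element of `Ω^k(TM)`. -/
def SmoothForm {k : ℕ} (β : ∀ x : M, TForm (N := N) k x) : Prop :=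
  ContMDiff (𝓡 N) ((𝓡 N).prod 𝓘(ℝ, VForm N k)) ∞
    (fun x => TotalSpace.mk' (VForm N k) (E := fun x : M => TForm (N := N) k x) x (β x))

/-- The space `Γ(F)` of smooth sections of `Λ^k T^*M ⊗ TM` with values in a family `F`. -/
def smoothSections {k : ℕ} (F : ∀ x : M, Set (TForm (N := N) k x)) :
    Set (∀ x : M, TForm (N := N) k x) :=
  {β | SmoothForm β ∧ ∀ x, β x ∈ F x}

/-- The frame at `x` of the coordinate vector fields of the preferred chart at `x`. -/
def coordFrame (x : M) : Frame (N := N) x :=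
  ((trivializationAt (Eu N) (TangentSpace (𝓡 N) : M → Type _) x).continuousLinearEquivAt ℝ x
    (FiberBundle.mem_baseSet_trivializationAt' x)).symm

/-- The vector field whose coordinates in the preferred chart at `x` are constant, equal to `w`
(it is meaningful in the domain of that chart). -/
def coordField (x : M) (w : Eu N) (y : M) : TangentSpace (𝓡 N) y :=
  (trivializationAt (Eu N) (TangentSpace (𝓡 N) : M → Type _) x).symmL ℝ y w

/-- The coordinate vector fields at `x` are differentiable at `x`. -/
theorem mdifferentiableAt_coordField (x : M) (w : Eu N) :
    MDifferentiableAt (𝓡 N) (𝓡 N).tangent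
      (fun y => (⟨y, coordField x w y⟩ : TangentBundle (𝓡 N) M)) x := by
  have hx : x ∈ (trivializationAt (Eu N) (TangentSpace (𝓡 N) : M → Type _) x).baseSet :=
    FiberBundle.mem_baseSet_trivializationAt' x
  refine (mdifferentiableAt_section (𝓡 N) (F := Eu N) (coordField x w)).2 ?_
  refine (mdifferentiableAt_const (c := w)).congr_of_eventuallyEq ?_
  filter_upwards [(trivializationAt (Eu N) (TangentSpace (𝓡 N) : M → Type _)
    x).open_baseSet.mem_nhds hx] with y hy
  rw [← Trivialization.continuousLinearMapAt_apply_of_mem (R := ℝ) _ hy]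
  exact Trivialization.continuousLinearMapAt_symmL _ hy w

/-- The connection form `ω` at `x` of a covariant derivative on `TM` with respect to the coordinate
vector fields of the preferred chart at `x`, written in coordinates: for `w, v ∈ V`,
`connForm cov x w v` holds the coordinates of `∇_v W` at `x`, where `W` is the vector field with
constant coordinates `w`; so `ω(v) w = connForm cov x w v`. -/
def connForm (cov : CovariantDerivative (𝓡 N) (Eu N) (TangentSpace (𝓡 N) : M → Type _)) (x : M) :
    Eu N →L[ℝ] Eu N →L[ℝ] Eu N :=
  LinearMap.toContinuousLinearMap
    { toFun := fun w =>
        (coordFrame (N := N) x).symm.toContinuousLinearMap ∘L cov (coordField x w) x ∘L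
          (coordFrame (N := N) x).toContinuousLinearMap
      map_add' := fun w w' => by
        have h : coordField x (w + w') = coordField x w + coordField x w' := by
          ext1 y
          exact map_add _ w w'
        rw [h, cov.isCovariantDerivativeOn.add (mdifferentiableAt_coordField x w)
          (mdifferentiableAt_coordField x w')]
        ext v
        simp
      map_smul' := fun a w => by
        have h : coordField x (a • w) = a • coordField x w := by
          ext1 y
          exact map_smul _ a w
        rw [h, cov.isCovariantDerivativeOn.smul_const a (mdifferentiableAt_coordField x w)]
        ext v
        simp }

/-- The covariant exterior derivative `d^∇ : Ω^k(TM) → Ω^{k+1}(TM)`. At `x` it is computed as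
`dβ + ω ∧ β` in the frame of coordinate vector fields of the preferred chart at `x`, where `ω` is
the connection form of that frame. -/
def covExtDeriv (cov : CovariantDerivative (𝓡 N) (Eu N) (TangentSpace (𝓡 N) : M → Type _))
    {k : ℕ} (β : ∀ x : M, TForm (N := N) k x) (x : M) : TForm (N := N) (k + 1) x :=
  (coordFrame (N := N) x).push <| ContinuousAlternatingMap.alternatizeUncurryFin <|
    mvfderiv (𝓡 N) (fun y : M => ContinuousAlternatingMap.inCoordinates (Eu N) (Eu N)
        (E₁ := fun y : M => TangentSpace (𝓡 N) y) (E₂ := fun y : M => TangentSpace (𝓡 N) y)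
        x y x y (β y)) x ∘L (coordFrame (N := N) x).toContinuousLinearMap +
      (ContinuousLinearMap.compContinuousAlternatingMapCLM (ι := Fin k) ℝ
        (Eu N) (Eu N) (Eu N)).flip ((coordFrame (N := N) x).pull (β x)) ∘L (connForm cov x).flip

/-- The metric `g_Q` of a `G`-structure: `g_Q(v, w) = ⟨u⁻¹ v, u⁻¹ w⟩` for an adapted frame `u`. -/
def GStructure.metric {G : Subgroup (Eu N ≃ₗᵢ[ℝ] Eu N)} (Q : GStructure G M) (x : M)
    (v w : TangentSpace (𝓡 N) x) : ℝ :=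
  inner ℝ ((Q.nonempty x).some.symm v) ((Q.nonempty x).some.symm w)

/-- The metric does not depend on the chosen adapted frame, as `G` consists of isometries. -/
theorem GStructure.metric_eq {G : Subgroup (Eu N ≃ₗᵢ[ℝ] Eu N)} (Q : GStructure G M) (x : M)
    (u : Frame (N := N) x) (hu : u ∈ Q.frames x) (v w : TangentSpace (𝓡 N) x) :
    Q.metric x v w = inner ℝ (u.symm v) (u.symm w) := by
  obtain ⟨g, -, hg⟩ := (Q.orbit x u hu _).1 (Q.nonempty x).some_mem
  have h : ∀ z : TangentSpace (𝓡 N) x, u.symm z = g ((Q.nonempty x).some.symm z) := by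
    intro z
    rw [ContinuousLinearEquiv.symm_apply_eq, ← hg, ContinuousLinearEquiv.apply_symm_apply]
  rw [h, h, LinearIsometryEquiv.inner_map_map]
  rfl

/-- A covariant derivative on `TM` is the Levi-Civita connection of the metric `g`: it is smooth,
torsion-free and metric, i.e. `v (g(σ, τ)) = g(∇_v σ, τ) + g(σ, ∇_v τ)`. -/
structure IsLeviCivita (g : ∀ x : M, TangentSpace (𝓡 N) x → TangentSpace (𝓡 N) x → ℝ)
    (cov : CovariantDerivative (𝓡 N) (Eu N) (TangentSpace (𝓡 N) : M → Type _)) : Prop where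
  smooth : cov.ContMDiffCovariantDerivative ∞
  torsion : cov.torsion = 0
  metric : ∀ (σ τ : ∀ x : M, TangentSpace (𝓡 N) x) (x : M),
    MDifferentiableAt (𝓡 N) (𝓡 N).tangent (fun y => (⟨y, σ y⟩ : TangentBundle (𝓡 N) M)) x →
    MDifferentiableAt (𝓡 N) (𝓡 N).tangent (fun y => (⟨y, τ y⟩ : TangentBundle (𝓡 N) M)) x →
    ∀ v : TangentSpace (𝓡 N) x,
      mvfderiv (𝓡 N) (fun y => g y (σ y) (τ y)) x v = g x (cov σ x v) (τ x) + g x (σ x) (cov τ x v)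

/-- A covariant derivative on `TM` is a connection on `Q`, i.e. it comes from a connection on the
principal bundle of adapted frames: its connection form in every smooth local adapted frame `s`,
the endomorphism-valued form `ω` with `∇_v (s w) = s (ω(v) w)`, takes its values in `𝔤`. -/
def GStructure.IsConnection {G : Subgroup (Eu N ≃ₗᵢ[ℝ] Eu N)} (Q : GStructure G M)
    (cov : CovariantDerivative (𝓡 N) (Eu N) (TangentSpace (𝓡 N) : M → Type _)) : Prop :=
  ∀ (U : Set M) (s : ∀ y : M, Frame (N := N) y), IsOpen U → (∀ y ∈ U, s y ∈ Q.frames y) →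
    SmoothFramesOn s U → ∀ x ∈ U, ∀ v : TangentSpace (𝓡 N) x,
      ∃ A ∈ lieAlg G, ∀ w : Eu N, cov (fun y => s y w) x v = s x (A w)

/-- `Q` is torsion-free: the Levi-Civita connection of `g_Q` is a connection on `Q`. -/
def GStructure.IsTorsionFree {G : Subgroup (Eu N ≃ₗᵢ[ℝ] Eu N)} (Q : GStructure G M) : Prop :=
  ∀ cov : CovariantDerivative (𝓡 N) (Eu N) (TangentSpace (𝓡 N) : M → Type _),
    IsLeviCivita Q.metric cov → Q.IsConnection cov

/-- The fibre at `x` of the bundle associated with `Q` and `𝔤^k`, inside `Λ^k T^*M ⊗ TM`. -/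
def GStructure.gHat {G : Subgroup (Eu N ≃ₗᵢ[ℝ] Eu N)} (Q : GStructure G M) (k : ℕ) (x : M) :
    Set (TForm (N := N) k x) :=
  {b | ∃ u ∈ Q.frames x, ∃ a ∈ gPow G k, b = Frame.push u a}

/-- The fibre at `x` of the bundle associated with `Q` and `P^k`, inside `Λ^k T^*M ⊗ TM`. -/
def GStructure.pHat {G : Subgroup (Eu N ≃ₗᵢ[ℝ] Eu N)} (Q : GStructure G M) (k : ℕ) (x : M) :
    Set (TForm (N := N) k x) :=
  {b | ∃ u ∈ Q.frames x, ∃ a ∈ pPow G k, b = Frame.push u a}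

/-- The orthogonal projection of `Λ^k T_x^*M ⊗ T_x M` onto the fibre of `pHat`, computed in an
adapted frame. -/
def GStructure.pr {G : Subgroup (Eu N ≃ₗᵢ[ℝ] Eu N)} (Q : GStructure G M) {k : ℕ} (x : M)
    (b : TForm (N := N) k x) : TForm (N := N) k x :=
  Frame.push (Q.nonempty x).some (prP G k (Frame.pull (Q.nonempty x).some b))

/-- The operator `d^Q`: the covariant exterior derivative followed by the projection. -/
def GStructure.dQ {G : Subgroup (Eu N ≃ₗᵢ[ℝ] Eu N)} (Q : GStructure G M)
    (cov : CovariantDerivative (𝓡 N) (Eu N) (TangentSpace (𝓡 N) : M → Type _))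
    {k : ℕ} (β : ∀ x : M, TForm (N := N) k x) (x : M) : TForm (N := N) (k + 1) x :=
  Q.pr x (covExtDeriv cov β x)

end GStr

end

noncomputable section

set_option synthInstance.maxHeartbeats 200000

namespace GStr

open ContinuousAlternatingMap (alternatizeUncurryFin alternatizeUncurryFinCLM)

section

variable {E F : Type*} [NormedAddCommGroup E] [NormedSpace ℝ E] [NormedAddCommGroup F]
  [NormedSpace ℝ F]

/-! ### Transport and infinitesimal action on vector-valued forms -/

/-! Write d for the covariant exterior derivative. Its square is the product with the curvature, `R
∧ β`, and `R` takes values in `𝔤` because the connection reduces to `Q`. This alone does not put `R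
∧ β` in `𝔤^{k+2}`: the endomorphism `R(v,w)` is applied to the value of `β`, whereas a generator `α
∧ A` feeds one of the form's arguments to `A`. The first Bianchi identity trades one for the other,
`R(v,w)b = R(v,b)w - R(w,b)v`. Writing `β = ∑ β^j ⊗ e_j`, the product becomes twice the alternation
in `v` of `∑ β^j ∧ R(v, e_j)`, up to sign. Each such sum lies in `𝔤^{k+1}`, and exterior
multiplication by one-forms maps `𝔤^{k+1}` to `𝔤^{k+2}` (`alt₂_postcomp_eq_of_bianchi`,
`alt₂_postcomp_mem_gPow`).

For the complex, d also preserves sections of the bundles `𝔤^k`: in an adapted frame both the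
derivative of the coordinates and the action of the connection form stay in `𝔤^k`, and alternation
lands in `𝔤^{k+1}`. Hence with `θ = dβ - pr dβ`, a section of the bundle of `𝔤^{k+1}`, the form
`d(pr dβ) = ddβ - dθ` has values in `𝔤^{k+2}` and is killed by the projection.

Two local descriptions of d are used. In a chart frame it is `db + Γ ∧ b` (`flatD`), which can be
iterated to reach the curvature. In an arbitrary smooth frame it is the alternation of the full
covariant derivative of the form (`pull_covExtDeriv`), which shows membership in an adapted frame.
Symmetry of the Christoffel symbols makes the two agree, and `frame_curvature` carries the curvature
between the frames. -/

/-- The endomorphism `b ↦ p ∘ b ∘ (q × ⋯ × q)` of `Λ^k V^* ⊗ V`. -/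
def transport {k : ℕ} (p q : E →L[ℝ] E) : (E [⋀^Fin k]→L[ℝ] E) →L[ℝ] E [⋀^Fin k]→L[ℝ] E :=
  ContinuousLinearMap.compContinuousAlternatingMapCLM ℝ (E) (E) (E) (Fin k) p ∘L
    ContinuousAlternatingMap.compContinuousLinearMapCLM q

@[simp]
theorem transport_apply {k : ℕ} (p q : E →L[ℝ] E) (b : E [⋀^Fin k]→L[ℝ] E) (v : Fin k → E) :
    transport p q b v = p (b fun i => q (v i)) := rfl

theorem transport_transport {k : ℕ} (p q p' q' : E →L[ℝ] E) (b : E [⋀^Fin k]→L[ℝ] E) :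
    transport p q (transport p' q' b) = transport (p ∘L p') (q' ∘L q) b := rfl

theorem transport_id {k : ℕ} (b : E [⋀^Fin k]→L[ℝ] E) :
    transport (ContinuousLinearMap.id ℝ (E)) (ContinuousLinearMap.id ℝ (E)) b = b := rfl

/-- The composition `A ∘ b` of `b ∈ Λ^k V^* ⊗ V` and `A ∈ End V`, linear in `A`. -/
def postcomp {k : ℕ} (b : E [⋀^Fin k]→L[ℝ] E) : (E →L[ℝ] E) →L[ℝ] E [⋀^Fin k]→L[ℝ] E :=
  (ContinuousLinearMap.compContinuousAlternatingMapCLM ℝ (E) (E) (E) (Fin k)).flip b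

@[simp]
theorem postcomp_apply {k : ℕ} (b : E [⋀^Fin k]→L[ℝ] E) (A : E →L[ℝ] E) (v : Fin k → E) :
    postcomp b A v = A (b v) := rfl

/-- The infinitesimal action of `End V` on `Λ^k V^* ⊗ V`. -/
def act {k : ℕ} : (E [⋀^Fin k]→L[ℝ] E) →L[ℝ] (E →L[ℝ] E) →L[ℝ] E [⋀^Fin k]→L[ℝ] E :=
  (ContinuousLinearMap.compContinuousAlternatingMapCLM ℝ E E E (Fin k)).flip -
    ContinuousAlternatingMap.fderivCompContinuousLinearMapCLM (ι := Fin k) E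
      (ContinuousLinearMap.id ℝ E)

theorem act_eq {k : ℕ} (b : E [⋀^Fin k]→L[ℝ] E) :
    act b = postcomp b - b.fderivCompContinuousLinearMap (ContinuousLinearMap.id ℝ (E)) := rfl

/-- The derivative of `(p, q, b) ↦ transport p q b`. -/
def transportDeriv {k : ℕ} (p q : E →L[ℝ] E) (b : E [⋀^Fin k]→L[ℝ] E)
    (p' q' : E →L[ℝ] E) (b' : E [⋀^Fin k]→L[ℝ] E) : E [⋀^Fin k]→L[ℝ] E :=
  transport p' q b + transport p q b' +
    transport p (ContinuousLinearMap.id ℝ (E)) (b.fderivCompContinuousLinearMap q q')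

theorem exists_hasFDerivAt_transport {k : ℕ} (p q : E →L[ℝ] E) (b : E [⋀^Fin k]→L[ℝ] E) :
    ∃ D : (E →L[ℝ] E) × (E →L[ℝ] E) × (E [⋀^Fin k]→L[ℝ] E) →L[ℝ] E [⋀^Fin k]→L[ℝ] E,
      HasFDerivAt (fun x : (E →L[ℝ] E) × (E →L[ℝ] E) × (E [⋀^Fin k]→L[ℝ] E) =>
      transport x.1 x.2.1 x.2.2) D (p, q, b) ∧
      ∀ p' q' b', D (p', q', b') = transportDeriv p q b p' q' b' := by
  have h3 := HasFDerivAt.continuousAlternatingMapCompContinuousLinearMap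
    (HasFDerivAt.snd (𝕜 := ℝ) (hasFDerivAt_snd (p := (p, q, b))))
    (HasFDerivAt.fst (𝕜 := ℝ) (hasFDerivAt_snd (p := (p, q, b))))
  have h4 := ContinuousLinearMap.hasFDerivAt_of_bilinear
    (ContinuousLinearMap.compContinuousAlternatingMapCLM ℝ E E E (Fin k))
    (hasFDerivAt_fst (𝕜 := ℝ) (p := (p, q, b))) h3
  refine ⟨_, h4, fun p' q' b' => ?_⟩
  ext v : 1
  simp [transportDeriv]
  rw [add_comm, ← add_assoc]
  rfl

/-- A family of forms is as smooth as its values on fixed vectors. -/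
theorem contDiff_form_of_apply [FiniteDimensional ℝ E] {k : ℕ} {X : Type*}
    [NormedAddCommGroup X] [NormedSpace ℝ X] {n : WithTop ℕ∞} {f : X → E [⋀^Fin k]→L[ℝ] E}
    (hf : ∀ v, ContDiff ℝ n fun x => f x v) : ContDiff ℝ n f := by
  let ev : (E [⋀^Fin k]→L[ℝ] E) →ₗ[ℝ] ((Fin k → Fin (Module.finrank ℝ E)) → E) :=
    { toFun := fun a I => a fun j => Module.finBasis ℝ E (I j)
      map_add' := fun a b => rfl
      map_smul' := fun c a => rfl }
  have hker : LinearMap.ker ev = ⊥ := by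
    rw [LinearMap.ker_eq_bot']
    intro a ha
    exact ContinuousAlternatingMap.toAlternatingMap_injective
      ((Module.finBasis ℝ E).ext_alternating fun I _ => congrFun ha I)
  obtain ⟨r, hr⟩ := ev.exists_leftInverse_of_injective hker
  have h : f = fun x => (LinearMap.toContinuousLinearMap r) (ev (f x)) := by
    ext1 x
    exact (LinearMap.congr_fun hr (f x)).symm
  rw [h]
  exact (ContinuousLinearMap.contDiff _).comp (contDiff_pi.2 fun I => hf _)

theorem contDiff_transport [FiniteDimensional ℝ E] {k : ℕ} {n : WithTop ℕ∞} :
    ContDiff ℝ n (fun x : (E →L[ℝ] E) × (E →L[ℝ] E) × (E [⋀^Fin k]→L[ℝ] E) =>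
      transport x.1 x.2.1 x.2.2) := by
  refine contDiff_form_of_apply fun v => ?_
  have h1 : ContDiff ℝ n (fun x : (E →L[ℝ] E) × (E →L[ℝ] E) × (E [⋀^Fin k]→L[ℝ] E) =>
      ContinuousMultilinearMap.compContinuousLinearMapContinuousMultilinear ℝ
        (fun _ : Fin k => E) (fun _ => E) (E) (fun _ => x.2.1)
        (ContinuousAlternatingMap.toContinuousMultilinearMapCLM ℝ x.2.2)) := by
    refine ContDiff.clm_apply ?_ ?_
    · exact (ContinuousMultilinearMap.contDiff _).comp
        (contDiff_pi.2 fun _ => contDiff_fst.comp contDiff_snd)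
    · exact (ContinuousLinearMap.contDiff _).comp (contDiff_snd.comp contDiff_snd)
  exact contDiff_fst.clm_apply
    ((ContinuousMultilinearMap.apply ℝ (fun _ : Fin k => E) (E) v).contDiff.comp h1)

/-- The infinitesimal action is compatible with a change of frame. -/
theorem transportDeriv_add_act {k : ℕ} (e f A Γ : E →L[ℝ] E) (b b' : E [⋀^Fin k]→L[ℝ] E) :
    transportDeriv e f b (e ∘L A - Γ ∘L e) (f ∘L Γ - A ∘L f) b' + act (transport e f b) Γ =
      transport e f (b' + act b A) := by
  -- The entry `f ∘L Γ - A ∘L f` in slot `i` splits by multilinearity: its `Γ` half cancels the slot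
  -- terms of `act (transport e f b) Γ`, its `A` half supplies those of `act b A`.
  have h1 : ∀ (v : Fin k → E) (i : Fin k),
      (b fun j => (Function.update (fun _ => f) i (f ∘L Γ - A ∘L f) j) (v j)) =
        (b fun j => f ((Function.update (fun _ => ContinuousLinearMap.id ℝ (E)) i Γ j) (v j))) -
        (b fun j => (Function.update (fun _ => ContinuousLinearMap.id ℝ (E)) i A j)
          (f (v j))) := by
    intro v i
    have e1 : (fun j => (Function.update (fun _ => f) i (f ∘L Γ - A ∘L f) j) (v j)) =
        Function.update (fun j => f (v j)) i (f (Γ (v i)) - A (f (v i))) := by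
      ext1 j
      rcases eq_or_ne j i with rfl | h <;> simp [*]
    have e2 : (fun j => f ((Function.update (fun _ => ContinuousLinearMap.id ℝ (E)) i Γ j)
        (v j))) = Function.update (fun j => f (v j)) i (f (Γ (v i))) := by
      ext1 j
      rcases eq_or_ne j i with rfl | h <;> simp [*]
    have e3 : (fun j => (Function.update (fun _ => ContinuousLinearMap.id ℝ (E)) i A j)
        (f (v j))) = Function.update (fun j => f (v j)) i (A (f (v i))) := by
      ext1 j
      rcases eq_or_ne j i with rfl | h <;> simp [*]
    rw [e1, e2, e3, ContinuousAlternatingMap.map_update_sub]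
  ext1 v
  simp only [transportDeriv, act_eq, sub_apply,
    ContinuousAlternatingMap.add_apply, ContinuousAlternatingMap.sub_apply, transport_apply,
    postcomp_apply, ContinuousAlternatingMap.fderivCompContinuousLinearMap_apply, h1, map_add,
    ContinuousLinearMap.comp_apply, ContinuousLinearMap.id_apply]
  simp only [map_sum, map_sub, Finset.sum_sub_distrib]
  abel

/-! ### Alternation -/

theorem alternatize_transport {k : ℕ} (e f : E →L[ℝ] E)
    (L : E →L[ℝ] E [⋀^Fin k]→L[ℝ] E) :
    alternatizeUncurryFin (transport e f ∘L L ∘L f) =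
      transport e f (alternatizeUncurryFin L) := by
  ext1 v
  simp only [ContinuousAlternatingMap.alternatizeUncurryFin_apply, transport_apply, map_sum,
    map_zsmul, ContinuousLinearMap.comp_apply]
  rfl

/-- The action on the covector slots inserts `Γ v (v i)`, symmetric in two arguments that are then
alternated. Thus, without torsion, the alternated covariant derivative is `dβ + ω ∧ β`. -/
theorem alternatize_act_of_symmetric {k : ℕ} (b : E [⋀^Fin k]→L[ℝ] E)
    {Γ : E →L[ℝ] E →L[ℝ] E} (hΓ : ∀ v w, Γ v w = Γ w v) :
    alternatizeUncurryFin (act b ∘L Γ) = alternatizeUncurryFin (postcomp b ∘L Γ) := by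
  have h : act b ∘L Γ + b.fderivCompContinuousLinearMap (ContinuousLinearMap.id ℝ (E)) ∘L Γ =
      postcomp b ∘L Γ := by
    ext v : 1
    simp [act_eq]
  rw [← h, ContinuousAlternatingMap.alternatizeUncurryFin_add,
    ContinuousAlternatingMap.alternatizeUncurryFin_fderivCompContinuousLinearMap_eq_zero _ _ hΓ,
    add_zero]

/-- Double alternation of a bilinear map with values in forms. -/
def alt₂ {k : ℕ} :
    (E →L[ℝ] E →L[ℝ] E [⋀^Fin k]→L[ℝ] F) →ₗ[ℝ] E [⋀^Fin (k + 2)]→L[ℝ] F where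
  toFun f := alternatizeUncurryFin (alternatizeUncurryFinCLM ℝ E F ∘L f)
  map_add' f g := by
    rw [ContinuousLinearMap.comp_add, ContinuousAlternatingMap.alternatizeUncurryFin_add]
  map_smul' c f := by
    rw [ContinuousLinearMap.comp_smul, ContinuousAlternatingMap.alternatizeUncurryFin_smul]
    rfl

theorem alt₂_of_symmetric {k : ℕ} {f : E →L[ℝ] E →L[ℝ] E [⋀^Fin k]→L[ℝ] F}
    (hf : ∀ x y, f x y = f y x) : alt₂ f = 0 :=
  ContinuousAlternatingMap.alternatizeUncurryFin_alternatizeUncurryFinCLM_comp_of_symmetric hf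

theorem alt₂_flip {k : ℕ} (f : E →L[ℝ] E →L[ℝ] E [⋀^Fin k]→L[ℝ] F) :
    alt₂ f.flip = - alt₂ f := by
  rw [eq_neg_iff_add_eq_zero, ← map_add]
  exact alt₂_of_symmetric fun x y => by exact add_comm _ _


/-- Exterior multiplication by a one-form, on the left. -/
def oneFormWedge {k : ℕ} (φ : E →L[ℝ] ℝ) : (E [⋀^Fin k]→L[ℝ] F) →ₗ[ℝ] E [⋀^Fin (k + 1)]→L[ℝ] F where
  toFun a := alternatizeUncurryFin (φ.smulRight a)
  map_add' a b := by
    rw [← ContinuousAlternatingMap.alternatizeUncurryFin_add]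
    congr 1
    ext v : 1
    simp
  map_smul' c a := by
    rw [RingHom.id_apply, ← ContinuousAlternatingMap.alternatizeUncurryFin_smul]
    congr 1
    ext v u
    change φ v • c • a u = c • φ v • a u
    rw [smul_comm]

/-- Under the Bianchi identity, `R ∧ b` is the alternation of forms `(S ∘ b) ∧ id` with
`S = R(v, ·)`. -/
theorem alt₂_postcomp_eq_of_bianchi {k : ℕ} (b : E [⋀^Fin k]→L[ℝ] E)
    {R : E →L[ℝ] E →L[ℝ] E →L[ℝ] E}
    (hskew : ∀ v w, R v w = - R w v) (hB : ∀ u v w, R u v w + R v w u + R w u v = 0) :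
    ∃ L : E →L[ℝ] E [⋀^Fin (k + 1)]→L[ℝ] E,
      (∀ v, L v = alternatizeUncurryFin (postcomp b ∘L (R v).flip)) ∧
      alt₂ (ContinuousLinearMap.postcomp E (postcomp b) ∘L R) =
        alternatizeUncurryFin L + alternatizeUncurryFin L := by
  let H : E →L[ℝ] E →L[ℝ] E [⋀^Fin k]→L[ℝ] E := ContinuousLinearMap.postcomp E (postcomp b) ∘L
    (ContinuousLinearMap.flipₗᵢ ℝ E E E).toContinuousLinearEquiv.toContinuousLinearMap ∘L R
  have hH : ∀ v w u, H v w u = R v (b u) w := fun v w u => rfl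
  -- Bianchi for `v`, `w` and the value `b u`. As `alt₂ H.flip = - alt₂ H`, alternating gives the
  -- factor two.
  have h1 : ContinuousLinearMap.postcomp E (postcomp b) ∘L R + H.flip = H := by
    ext v w u : 3
    change R v w (b u) + R w (b u) v = R v (b u) w
    have h := hB v w (b u)
    rw [hskew (b u) v] at h
    have h' : (-R v (b u)) w = -(R v (b u) w) := rfl
    rw [← sub_eq_zero, ← h, h']
    abel
  refine ⟨alternatizeUncurryFinCLM ℝ E E ∘L H, fun v => rfl, ?_⟩
  have h2 := congrArg alt₂ h1
  rw [map_add, alt₂_flip, ← sub_eq_add_neg, sub_eq_iff_eq_add] at h2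
  exact h2

end

section

/-! ### The Lie algebra and the spaces `𝔤^k` -/

/-- Membership in a subspace becomes a linear equation, which can be differentiated: derivatives of
`S`-valued maps are `S`-valued. -/
theorem exists_clm_mem_iff {X : Type*} [NormedAddCommGroup X] [NormedSpace ℝ X]
    [FiniteDimensional ℝ X] (S : Submodule ℝ X) : ∃ P : X →L[ℝ] X, ∀ x, x ∈ S ↔ P x = 0 := by
  obtain ⟨T, hT⟩ := S.exists_isCompl
  refine ⟨LinearMap.toContinuousLinearMap (T.projection S hT.symm), fun x => ?_⟩
  rw [LinearMap.coe_toContinuousLinearMap', ← LinearMap.mem_ker, Submodule.ker_projection]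

theorem hasFDerivAt_mem_submodule {X Y : Type*} [NormedAddCommGroup X] [NormedSpace ℝ X]
    [FiniteDimensional ℝ X] [NormedAddCommGroup Y] [NormedSpace ℝ Y] {S : Submodule ℝ X}
    {f : Y → X} {f' : Y →L[ℝ] X} {y : Y} (hf : HasFDerivAt f f' y) (hS : ∀ᶠ z in 𝓝 y, f z ∈ S)
    (v : Y) : f' v ∈ S := by
  obtain ⟨P, hP⟩ := exists_clm_mem_iff S
  have h1 : HasFDerivAt (fun z => P (f z)) (P ∘L f') y := P.hasFDerivAt.comp y hf
  have h2 : HasFDerivAt (fun z => P (f z)) (0 : Y →L[ℝ] X) y :=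
    (hasFDerivAt_const (0 : X) y).congr_of_eventuallyEq (hS.mono fun z hz => (hP _).1 hz)
  rw [hP]
  exact congrArg (fun L : Y →L[ℝ] X => L v) (h1.unique h2)

theorem hasDerivAt_mem_submodule {X : Type*} [NormedAddCommGroup X] [NormedSpace ℝ X]
    [FiniteDimensional ℝ X] {S : Submodule ℝ X} {f : ℝ → X} {f' : X} {t : ℝ}
    (hf : HasDerivAt f f' t) (hS : ∀ s, f s ∈ S) : f' ∈ S := by
  simpa using hasFDerivAt_mem_submodule hf.hasFDerivAt (Filter.Eventually.of_forall hS) 1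

instance finiteDimensional_vform (N k : ℕ) : FiniteDimensional ℝ (VForm N k) := by
  refine FiniteDimensional.of_injective (V₂ := (Fin k → Fin N) → Eu N)
    { toFun := fun a I => a fun j => EuclideanSpace.single (I j) (1 : ℝ)
      map_add' := fun a b => rfl
      map_smul' := fun c a => rfl } ?_
  rw [← LinearMap.ker_eq_bot, LinearMap.ker_eq_bot']
  intro a ha
  refine formInner_self_eq_zero (Finset.sum_eq_zero fun I _ => ?_)
  rw [show (a fun j => EuclideanSpace.single (I j) (1 : ℝ)) = 0 from congrFun ha I]
  exact inner_zero_left _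

/-- The endomorphism of `V` underlying a linear isometry. -/
abbrev isoCLM {N : ℕ} (g : Eu N ≃ₗᵢ[ℝ] Eu N) : Eu N →L[ℝ] Eu N :=
  (g.toContinuousLinearEquiv : Eu N →L[ℝ] Eu N)

/-- A curve in `G` through the identity has an inverse curve, with the opposite velocity. -/
theorem exists_inverse_curve {N : ℕ} {G : Subgroup (Eu N ≃ₗᵢ[ℝ] Eu N)}
    {c : ℝ → (Eu N →L[ℝ] Eu N)} {A : Eu N →L[ℝ] Eu N}
    (hc : ∀ t, ∃ g ∈ G, ∀ w, c t w = g w) (h0 : c 0 = ContinuousLinearMap.id ℝ (Eu N))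
    (hA : HasDerivAt c A 0) :
    ∃ d : ℝ → (Eu N →L[ℝ] Eu N), d 0 = ContinuousLinearMap.id ℝ (Eu N) ∧ HasDerivAt d (-A) 0 ∧
      ∀ t, ∃ g ∈ G, c t = isoCLM g ∧ d t = isoCLM g⁻¹ := by
  choose g hg hcg using hc
  have hc' : ∀ t, c t = isoCLM (g t) := fun t => by ext1 w; exact hcg t w
  have hd' : ∀ t, ContinuousLinearMap.inverse (c t) = isoCLM (g t)⁻¹ := fun t => by
    rw [hc' t]
    exact ContinuousLinearMap.inverse_equiv (g t).toContinuousLinearEquiv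
  have hd0 : ContinuousLinearMap.inverse (c 0) = ContinuousLinearMap.id ℝ (Eu N) := by
    rw [h0]; exact ContinuousLinearMap.inverse_id
  have hinv : DifferentiableAt ℝ (fun t => ContinuousLinearMap.inverse (c t)) 0 := by
    have h := (contDiffAt_map_inverse (n := 1) (𝕜 := ℝ)
      (g 0).toContinuousLinearEquiv).differentiableAt one_ne_zero
    have h' : DifferentiableAt ℝ (ContinuousLinearMap.inverse : (Eu N →L[ℝ] Eu N) → _) (c 0) := by
      rw [hc' 0]; exact h
    exact h'.comp (0 : ℝ) hA.differentiableAt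
  have hprod := hinv.hasDerivAt.clm_comp hA
  -- The product rule applied to this constant curve forces the velocity of the inverse curve to be
  -- `-A`.
  have hone : (fun t => (ContinuousLinearMap.inverse (c t)).comp (c t)) =
      fun _ => ContinuousLinearMap.id ℝ (Eu N) := by
    ext1 t
    rw [hd' t, hc' t]
    ext1 w
    exact (g t).symm_apply_apply w
  rw [hone] at hprod
  have hz := hprod.unique (hasDerivAt_const _ _)
  rw [hd0, h0] at hz
  have hz' : deriv (fun t => ContinuousLinearMap.inverse (c t)) 0 = -A := by
    rw [eq_neg_iff_add_eq_zero]
    exact hz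
  refine ⟨_, hd0, hz' ▸ hinv.hasDerivAt, fun t => ⟨g t, hg t, hc' t, hd' t⟩⟩

theorem conj_mem_lieAlg {N : ℕ} {G : Subgroup (Eu N ≃ₗᵢ[ℝ] Eu N)} {g : Eu N ≃ₗᵢ[ℝ] Eu N}
    (hg : g ∈ G) {A : Eu N →L[ℝ] Eu N} (hA : A ∈ lieAlg G) :
    isoCLM g ∘L A ∘L isoCLM g⁻¹ ∈ lieAlg G := by
  obtain ⟨c, hc, hcG, hc0, hcA⟩ := hA
  refine ⟨fun t => isoCLM g ∘L c t ∘L isoCLM g⁻¹,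
    contDiff_const.clm_comp (hc.clm_comp contDiff_const), fun t => ?_, ?_, ?_⟩
  · obtain ⟨h, hh, hch⟩ := hcG t
    exact ⟨g * h * g⁻¹, G.mul_mem (G.mul_mem hg hh) (G.inv_mem hg), fun w =>
      congrArg g (hch _)⟩
  · ext1 w
    simp only [hc0]
    exact g.apply_symm_apply w
  · have h := (hasDerivAt_const (0 : ℝ) (isoCLM g)).clm_comp
      (hcA.clm_comp (hasDerivAt_const (0 : ℝ) (isoCLM g⁻¹)))
    simpa using h

/-- The curve `c(t) B c(t)⁻¹` stays in the Lie algebra, and its velocity at `0` is the bracket. -/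
theorem bracket_mem_lieAlg {N : ℕ} {G : Subgroup (Eu N ≃ₗᵢ[ℝ] Eu N)} {A B : Eu N →L[ℝ] Eu N}
    (hA : A ∈ lieAlg G) (hB : B ∈ lieAlg G) : A ∘L B - B ∘L A ∈ lieAlg G := by
  obtain ⟨c, hc, hcG, hc0, hcA⟩ := hA
  obtain ⟨d, hd0, hdA, hcd⟩ := exists_inverse_curve hcG hc0 hcA
  have h := hcA.clm_comp ((hasDerivAt_const (0 : ℝ) B).clm_comp hdA)
  refine hasDerivAt_mem_submodule (f := fun t => c t ∘L B ∘L d t) (t := 0) ?_ fun t => ?_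
  · convert! h using 1
    rw [hc0, hd0]
    ext1 w
    simp [sub_eq_add_neg]
  · obtain ⟨g, hg, h1, h2⟩ := hcd t
    simp only [h1, h2]
    exact conj_mem_lieAlg hg hB

theorem wedge_mem_gPow {N k : ℕ} {G : Subgroup (Eu N ≃ₗᵢ[ℝ] Eu N)}
    (α : Eu N [⋀^Fin k]→L[ℝ] ℝ) {A : Eu N →L[ℝ] Eu N} (hA : A ∈ lieAlg G) :
    wedge α A ∈ gPow G (k + 1) :=
  Submodule.subset_span ⟨α, A, hA, rfl⟩

/-- On generators, `g` sends `α ∧ A` to `(g⁻¹)^*α ∧ gAg⁻¹`. -/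
theorem transport_mem_gPow {N k : ℕ} {G : Subgroup (Eu N ≃ₗᵢ[ℝ] Eu N)} {g : Eu N ≃ₗᵢ[ℝ] Eu N}
    (hg : g ∈ G) {a : VForm N k} (ha : a ∈ gPow G k) :
    transport (isoCLM g) (isoCLM g⁻¹) a ∈ gPow G k := by
  cases k with
  | zero =>
    rw [(Submodule.mem_bot ℝ).1 ha, map_zero]
    exact zero_mem _
  | succ k =>
    refine Submodule.span_induction ?_ ?_ ?_ ?_ ha
    · rintro _ ⟨α, A, hA, rfl⟩
      have h : transport (isoCLM g) (isoCLM g⁻¹) (wedge α A) =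
          wedge (α.compContinuousLinearMap (isoCLM g⁻¹)) (isoCLM g ∘L A ∘L isoCLM g⁻¹) := by
        ext1 v
        simp only [transport_apply, wedge_apply, map_smul, map_sum]
        rfl
      rw [h]
      exact wedge_mem_gPow _ (conj_mem_lieAlg hg hA)
    · rw [map_zero]; exact zero_mem _
    · intro x y _ _ hx hy
      rw [map_add]; exact add_mem hx hy
    · intro c x _ hx
      rw [map_smul]; exact Submodule.smul_mem _ c hx

/-- The infinitesimal version of `transport_mem_gPow`: differentiate the action of a curve in `G`
with velocity `A`. -/
theorem act_mem_gPow {N k : ℕ} {G : Subgroup (Eu N ≃ₗᵢ[ℝ] Eu N)} {A : Eu N →L[ℝ] Eu N}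
    (hA : A ∈ lieAlg G) {a : VForm N k} (ha : a ∈ gPow G k) : act a A ∈ gPow G k := by
  obtain ⟨c, hc, hcG, hc0, hcA⟩ := hA
  obtain ⟨d, hd0, hdA, hcd⟩ := exists_inverse_curve hcG hc0 hcA
  obtain ⟨D, hD, hD'⟩ := exists_hasFDerivAt_transport (ContinuousLinearMap.id ℝ (Eu N))
    (ContinuousLinearMap.id ℝ (Eu N)) a
  have h1 : HasDerivAt (fun t => (c t, d t, a)) (A, -A, 0) 0 :=
    hcA.prodMk (hdA.prodMk (hasDerivAt_const _ _))
  have h2 : HasDerivAt (fun t => transport (c t) (d t) a) (D (A, -A, 0)) 0 := by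
    refine HasFDerivAt.comp_hasDerivAt_of_eq (0 : ℝ) hD h1 ?_
    rw [hc0, hd0]
  have h3 : D (A, -A, 0) = act a A := by
    rw [hD', act_eq]
    ext1 v
    simp [transportDeriv, sub_eq_add_neg]
  rw [← h3]
  refine hasDerivAt_mem_submodule h2 fun t => ?_
  obtain ⟨g, hg, h1, h2⟩ := hcd t
  simp only [h1, h2]
  exact transport_mem_gPow hg ha

end

/-! ### Exterior products and curvature terms in the spaces `𝔤^k` -/

section

/-- The form `b = ∑ b_j e_j` wedged with the endomorphisms `S e_j`. -/
theorem alternatize_postcomp_flip_mem_gPow {N k : ℕ} {G : Subgroup (Eu N ≃ₗᵢ[ℝ] Eu N)}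
    (b : VForm N k) (S : Eu N →L[ℝ] Eu N →L[ℝ] Eu N) (hS : ∀ v, S v ∈ lieAlg G) :
    alternatizeUncurryFin (postcomp b ∘L S.flip) ∈ gPow G (k + 1) := by
  -- The sign cancels the one in `wedge`, which places the one-form last, while
  -- `alternatizeUncurryFin` places it first.
  have h : alternatizeUncurryFin (postcomp b ∘L S.flip) =
      ∑ j, (-1 : ℝ) ^ k • wedge ((EuclideanSpace.proj j : Eu N →L[ℝ] ℝ).compContinuousAlternatingMap
        b) (S (EuclideanSpace.single j 1)) := by
    ext1 v
    simp only [ContinuousAlternatingMap.alternatizeUncurryFin_apply,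
      ContinuousAlternatingMap.sum_apply, ContinuousAlternatingMap.smul_apply, wedge_apply,
      smul_smul, ← mul_pow, mul_neg_one, neg_neg, one_pow, one_smul]
    rw [Finset.sum_comm]
    refine Finset.sum_congr rfl fun i _ => ?_
    have h1 : b (i.removeNth v) = ∑ j, (b (i.removeNth v)) j • EuclideanSpace.single j (1 : ℝ) := by
      conv_lhs => rw [← (EuclideanSpace.basisFun (Fin N) ℝ).sum_repr (b (i.removeNth v))]
      simp
    simp only [ContinuousLinearMap.comp_apply, postcomp_apply, ContinuousLinearMap.flip_apply]
    rw [h1, map_sum, _root_.sum_apply, Finset.smul_sum]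
    refine Finset.sum_congr rfl fun j _ => ?_
    rw [map_smul, smul_apply, mul_smul]
    rcases Nat.even_or_odd (i : ℕ) with h | h <;> simp [h.neg_one_pow]
  rw [h]
  exact Submodule.sum_mem _ fun j _ => Submodule.smul_mem _ _ (wedge_mem_gPow _ (hS _))

/-- Associativity of the exterior product. Both sides alternate `φ v • α u • A w` twice, with the
new variables in opposite orders; `alt₂_flip` accounts for the sign between `(-1)^k` and
`(-1)^(k+1)`. -/
theorem oneFormWedge_wedge {N k : ℕ} (φ : Eu N →L[ℝ] ℝ) (α : Eu N [⋀^Fin k]→L[ℝ] ℝ)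
    (A : Eu N →L[ℝ] Eu N) :
    oneFormWedge φ (wedge α A) = wedge (oneFormWedge φ α) A := by
  let W : Eu N →L[ℝ] VForm N k :=
    (ContinuousLinearMap.compContinuousAlternatingMapCLM (ι := Fin k) ℝ (Eu N) ℝ (Eu N)).flip α ∘L
      (ContinuousLinearMap.toSpanSingletonCLE (𝕜 := ℝ) (E := Eu N) :
        Eu N →L[ℝ] (ℝ →L[ℝ] Eu N)) ∘L A
  have hW : ∀ w u, W w u = α u • A w := fun w u => rfl
  have h1 : oneFormWedge φ (wedge α A) =
      (-1 : ℝ) ^ k • alt₂ (φ.smulRight W) := by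
    change alternatizeUncurryFin _ = (-1 : ℝ) ^ k • alternatizeUncurryFin _
    rw [← ContinuousAlternatingMap.alternatizeUncurryFin_smul]
    congr 1
    ext1 v
    change φ v • (-1 : ℝ) ^ k • alternatizeUncurryFin W =
      (-1 : ℝ) ^ k • alternatizeUncurryFin (φ v • W)
    rw [ContinuousAlternatingMap.alternatizeUncurryFin_smul, smul_comm]
  have h2 : wedge (oneFormWedge φ α) A =
      (-1 : ℝ) ^ (k + 1) • alt₂ (φ.smulRight W).flip := by
    unfold wedge
    congr 1
    change _ = alternatizeUncurryFin _
    congr 1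
    ext w u : 2
    change alternatizeUncurryFin (φ.smulRight α) u • A w =
      alternatizeUncurryFin ((φ.smulRight W).flip w) u
    rw [ContinuousAlternatingMap.alternatizeUncurryFin_apply,
      ContinuousAlternatingMap.alternatizeUncurryFin_apply, Finset.sum_smul]
    refine Finset.sum_congr rfl fun i _ => ?_
    change ((-1) ^ (i : ℕ) • φ (u i) • α (i.removeNth u)) • A w =
      (-1) ^ (i : ℕ) • φ (u i) • α (i.removeNth u) • A w
    rw [smul_assoc, smul_assoc]
  rw [h1, h2, alt₂_flip, pow_succ]
  simp

/-- The exterior product of a one-form and an element of `𝔤^k` is in `𝔤^{k+1}`. -/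
theorem oneFormWedge_mem_gPow {N k : ℕ} {G : Subgroup (Eu N ≃ₗᵢ[ℝ] Eu N)}
    (φ : Eu N →L[ℝ] ℝ) {a : VForm N k} (ha : a ∈ gPow G k) :
    oneFormWedge φ a ∈ gPow G (k + 1) := by
  cases k with
  | zero =>
    rw [(Submodule.mem_bot ℝ).1 ha, map_zero]
    exact zero_mem _
  | succ k =>
    refine Submodule.span_induction (p := fun a _ =>
      oneFormWedge φ a ∈ gPow G (k + 1 + 1)) ?_ ?_ ?_ ?_ ha
    · rintro _ ⟨α, A, hA, rfl⟩
      rw [oneFormWedge_wedge]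
      exact wedge_mem_gPow _ hA
    · rw [map_zero]; exact zero_mem _
    · intro x y _ _ hx hy
      rw [map_add]; exact add_mem hx hy
    · intro c x _ hx
      rw [map_smul]; exact Submodule.smul_mem _ c hx

/-- Expanding `L = ∑ e^j ⊗ L(e_j)` turns the alternation into `∑ e^j ∧ L(e_j)`. -/
theorem alternatize_mem_gPow {N k : ℕ} {G : Subgroup (Eu N ≃ₗᵢ[ℝ] Eu N)}
    {L : Eu N →L[ℝ] VForm N k} (hL : ∀ v, L v ∈ gPow G k) :
    alternatizeUncurryFin L ∈ gPow G (k + 1) := by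
  have h : L = ∑ j, (EuclideanSpace.proj j : Eu N →L[ℝ] ℝ).smulRight
      (L (EuclideanSpace.single j 1)) := by
    ext1 v
    conv_lhs => rw [← (EuclideanSpace.basisFun (Fin N) ℝ).sum_repr v]
    simp
  rw [h, ← ContinuousAlternatingMap.alternatizeUncurryFinCLM_apply, map_sum]
  exact Submodule.sum_mem _ fun j _ => oneFormWedge_mem_gPow _ (hL _)

/-- The curvature form composed with a vector-valued form has its values in `𝔤^{k+2}`, by the
Bianchi identity. -/
theorem alt₂_postcomp_mem_gPow {N k : ℕ} {G : Subgroup (Eu N ≃ₗᵢ[ℝ] Eu N)}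
    (b : VForm N k) {R : Eu N →L[ℝ] Eu N →L[ℝ] Eu N →L[ℝ] Eu N} (hR : ∀ v w, R v w ∈ lieAlg G)
    (hskew : ∀ v w, R v w = - R w v) (hB : ∀ u v w, R u v w + R v w u + R w u v = 0) :
    alt₂ (ContinuousLinearMap.postcomp (Eu N) (postcomp b) ∘L R) ∈ gPow G (k + 2) := by
  obtain ⟨L, hL, h⟩ := alt₂_postcomp_eq_of_bianchi b hskew hB
  have h2 : alternatizeUncurryFin L ∈ gPow G (k + 2) := alternatize_mem_gPow fun v => by
    rw [hL]
    exact alternatize_postcomp_flip_mem_gPow b (R v) (hR v)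
  rw [h]
  exact add_mem h2 h2

/-! ### Orthogonal projections -/

/-- The form sums over all index tuples, so invariance is the orthogonality of the matrix of `g⁻¹`,
applied in each of the `k` slots. It makes the complements `P^k` invariant under `G`. -/
theorem formInner_transport {N k : ℕ} (g : Eu N ≃ₗᵢ[ℝ] Eu N) (a b : VForm N k) :
    formInner N k (transport (isoCLM g) (isoCLM g⁻¹) a) (transport (isoCLM g) (isoCLM g⁻¹) b) =
      formInner N k a b := by
  let e : Fin N → Eu N := fun i => EuclideanSpace.single i (1 : ℝ)
  let m : Fin N → Fin N → ℝ := fun i j => (g⁻¹ (e i)) j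
  have hm : ∀ i, g⁻¹ (e i) = ∑ j, m i j • e j := fun i => by
    conv_lhs => rw [← (EuclideanSpace.basisFun (Fin N) ℝ).sum_repr (g⁻¹ (e i))]
    simp [m, e]
  -- Parseval for `g (e j)` and `g (e l)`, since `m i j` is the inner product of `g (e j)` with `e
  -- i`.
  have horth : ∀ j l, ∑ i, m i j * m i l = if j = l then 1 else 0 := fun j l => by
    have h : ∀ i j, m i j = inner ℝ (g (e j)) (e i) := fun i j => by
      have h1 : g (g⁻¹ (e i)) = e i := g.apply_symm_apply _
      rw [← h1, LinearIsometryEquiv.inner_map_map]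
      exact ((EuclideanSpace.inner_single_left j (1 : ℝ) _).trans (by simp [m])).symm
    have h2 := (EuclideanSpace.basisFun (Fin N) ℝ).sum_inner_mul_inner (g (e j)) (g (e l))
    rw [LinearIsometryEquiv.inner_map_map] at h2
    simp only [h]
    simp only [EuclideanSpace.basisFun_apply] at h2
    calc _ = ∑ i, inner ℝ (g (e j)) (e i) * inner ℝ (e i) (g (e l)) :=
          Finset.sum_congr rfl fun i _ => by rw [real_inner_comm (e i) (g (e l))]
      _ = inner ℝ (e j) (e l) := h2
      _ = _ := (EuclideanSpace.inner_single_left j (1 : ℝ) _).trans (by simp [e])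
  have hexp : ∀ (c : VForm N k) (I : Fin k → Fin N),
      (c fun t => g⁻¹ (e (I t))) =
        ∑ J : Fin k → Fin N, (∏ t, m (I t) (J t)) • c fun t => e (J t) := fun c I => by
    have h1 : (fun t => g⁻¹ (e (I t))) = fun t => ∑ j, m (I t) j • e j := funext fun t => hm _
    rw [h1]
    refine (c.toMultilinearMap.map_sum fun t j => m (I t) j • e j).trans ?_
    exact Finset.sum_congr rfl fun J _ => c.toMultilinearMap.map_smul_univ _ _
  change ∑ I : Fin k → Fin N, inner ℝ (g (a fun t => g⁻¹ (e (I t)))) (g (b fun t => g⁻¹ (e (I t)))) =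
    ∑ I : Fin k → Fin N, inner ℝ (a fun t => e (I t)) (b fun t => e (I t))
  simp only [LinearIsometryEquiv.inner_map_map, hexp, sum_inner, inner_sum, real_inner_smul_left,
    real_inner_smul_right]
  rw [Finset.sum_comm]
  refine Finset.sum_congr rfl fun J _ => ?_
  rw [Finset.sum_comm]
  -- The sum over tuples `I` factors into a product over slots, each factor being a Kronecker delta.
  have key : ∀ K : Fin k → Fin N, ∑ I : Fin k → Fin N, (∏ t, m (I t) (J t)) * ((∏ t, m (I t) (K t)) *
      inner ℝ (a fun t => e (K t)) (b fun t => e (J t))) =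
      if J = K then inner ℝ (a fun t => e (K t)) (b fun t => e (J t)) else 0 := fun K => by
    simp only [← mul_assoc, ← Finset.prod_mul_distrib]
    rw [← Finset.sum_mul, ← Fintype.prod_sum fun t i => m i (J t) * m i (K t)]
    simp only [horth, Finset.prod_ite_zero, Finset.prod_const_one]
    by_cases hJK : J = K
    · simp [hJK]
    · rw [if_neg hJK, if_neg, zero_mul]
      exact fun h => hJK (funext fun t => h t (Finset.mem_univ t))
  refine (Finset.sum_congr rfl fun K _ => key K).trans ?_
  rw [Finset.sum_ite_eq, if_pos (Finset.mem_univ J)]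

theorem transport_mem_pPow {N k : ℕ} {G : Subgroup (Eu N ≃ₗᵢ[ℝ] Eu N)} {g : Eu N ≃ₗᵢ[ℝ] Eu N}
    (hg : g ∈ G) {a : VForm N k} (ha : a ∈ pPow G k) :
    transport (isoCLM g) (isoCLM g⁻¹) a ∈ pPow G k := by
  intro b hb
  have h := ha _ (transport_mem_gPow (G.inv_mem hg) hb)
  have e : b = transport (isoCLM g) (isoCLM g⁻¹) (transport (isoCLM g⁻¹) (isoCLM g⁻¹⁻¹) b) := by
    rw [transport_transport, inv_inv]
    have h1 : isoCLM g ∘L isoCLM g⁻¹ = ContinuousLinearMap.id ℝ (Eu N) := by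
      ext1 w
      exact g.apply_symm_apply w
    rw [h1, transport_id]
  change formInner N k _ _ = 0 at h
  change formInner N k _ _ = 0
  rw [e, formInner_transport, h]

theorem prP_eq_iff {N k : ℕ} {G : Subgroup (Eu N ≃ₗᵢ[ℝ] Eu N)} {a p : VForm N k} :
    prP G k a = p ↔ p ∈ pPow G k ∧ a - p ∈ gPow G k := by
  constructor
  · rintro rfl
    refine ⟨Submodule.projection_apply_mem _ _, ?_⟩
    rw [← Submodule.ker_projection (isCompl_pPow G k), LinearMap.mem_ker, map_sub, sub_eq_zero]
    exact (Submodule.projection_apply_left _ ⟨_, Submodule.projection_apply_mem _ _⟩).symm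
  · rintro ⟨h1, h2⟩
    rw [← Submodule.ker_projection (isCompl_pPow G k), LinearMap.mem_ker, map_sub,
      sub_eq_zero] at h2
    exact h2.trans (Submodule.projection_apply_left _ ⟨p, h1⟩)

/-- Both summands `P^k` and `𝔤^k` are `G`-invariant, so the projection is equivariant; hence the
bundle projection does not depend on the adapted frame. -/
theorem prP_transport {N k : ℕ} {G : Subgroup (Eu N ≃ₗᵢ[ℝ] Eu N)} {g : Eu N ≃ₗᵢ[ℝ] Eu N}
    (hg : g ∈ G) (a : VForm N k) :
    prP G k (transport (isoCLM g) (isoCLM g⁻¹) a) =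
      transport (isoCLM g) (isoCLM g⁻¹) (prP G k a) := by
  obtain ⟨h1, h2⟩ := prP_eq_iff.1 (rfl : prP G k a = _)
  refine prP_eq_iff.2 ⟨transport_mem_pPow hg h1, ?_⟩
  rw [← map_sub]
  exact transport_mem_gPow hg h2

end

section

variable {E F : Type*} [NormedAddCommGroup E] [NormedSpace ℝ E] [NormedAddCommGroup F]
  [NormedSpace ℝ F]

/-! ### The covariant exterior derivative on a vector space -/

theorem two_le_infty : (2 : WithTop ℕ∞) ≤ ∞ := by
  have h : ((2 : ℕ∞) : WithTop ℕ∞) ≤ ∞ := WithTop.coe_le_coe.2 le_top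
  exact h

/-- The hypothesis says that `f - g` is symmetric, stated without subtraction. -/
theorem alt₂_congr {k : ℕ} {f g : E →L[ℝ] E →L[ℝ] E [⋀^Fin k]→L[ℝ] F}
    (h : ∀ v w, f v w + g w v = f w v + g v w) : alt₂ f = alt₂ g := by
  have h1 : alt₂ (f + g.flip) = 0 := alt₂_of_symmetric fun v w => h v w
  rw [map_add, alt₂_flip, ← sub_eq_add_neg, sub_eq_zero] at h1
  exact h1

theorem hasFDerivAt_clm_comp {X Y Z : Type*} [NormedAddCommGroup X] [NormedSpace ℝ X]
    [NormedAddCommGroup Y] [NormedSpace ℝ Y] [NormedAddCommGroup Z] [NormedSpace ℝ Z]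
    (P : Y →L[ℝ] Z) {f : X → Y} {f' : X →L[ℝ] Y} {x : X} (hf : HasFDerivAt f f' x) :
    HasFDerivAt (fun y => P (f y)) (P ∘L f') x := P.hasFDerivAt.comp x hf

theorem hasFDerivAt_add {X Y : Type*} [NormedAddCommGroup X] [NormedSpace ℝ X]
    [NormedAddCommGroup Y] [NormedSpace ℝ Y] {f g : X → Y} {f' g' : X →L[ℝ] Y} {x : X}
    (hf : HasFDerivAt f f' x) (hg : HasFDerivAt g g' x) :
    HasFDerivAt (fun y => f y + g y) (f' + g') x := hf.add hg

theorem exists_hasFDerivAt_postcomp_comp {k : ℕ} {Γ : E → E →L[ℝ] E →L[ℝ] E}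
    {b : E → E [⋀^Fin k]→L[ℝ] E} {Γ' : E →L[ℝ] E →L[ℝ] E →L[ℝ] E}
    {b' : E →L[ℝ] E [⋀^Fin k]→L[ℝ] E} {z : E}
    (hΓ : HasFDerivAt Γ Γ' z) (hb : HasFDerivAt b b' z) :
    ∃ L' : E →L[ℝ] E →L[ℝ] E [⋀^Fin k]→L[ℝ] E,
      HasFDerivAt (fun z => postcomp (b z) ∘L Γ z) L' z ∧
      ∀ v w, L' v w = postcomp (b z) (Γ' v w) + postcomp (b' v) (Γ z w) := by
  have h1 := hasFDerivAt_clm_comp (X := E) (Y := E [⋀^Fin k]→L[ℝ] E)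
    (Z := (E →L[ℝ] E) →L[ℝ] E [⋀^Fin k]→L[ℝ] E)
    (ContinuousLinearMap.compContinuousAlternatingMapCLM ℝ E E E (Fin k)).flip hb
  exact ⟨_, h1.clm_comp hΓ, fun v w => rfl⟩

/-- The covariant exterior derivative on a vector space, for the connection form `Γ`. -/
def flatD {k : ℕ} (Γ : E → E →L[ℝ] E →L[ℝ] E) (b : E → E [⋀^Fin k]→L[ℝ] E) (z : E) :
    E [⋀^Fin (k + 1)]→L[ℝ] E :=
  alternatizeUncurryFin (fderiv ℝ b z + postcomp (b z) ∘L Γ z)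

set_option maxHeartbeats 1000000 in
/-- The square of the covariant exterior derivative is the product with the curvature. -/
theorem exists_flatD_flatD {k : ℕ} {Γ : E → E →L[ℝ] E →L[ℝ] E} {b : E → E [⋀^Fin k]→L[ℝ] E}
    {z : E} (hΓ : ContDiffAt ℝ ∞ Γ z) (hb : ContDiffAt ℝ ∞ b z) :
    ∃ R : E →L[ℝ] E →L[ℝ] E →L[ℝ] E,
      (∀ v w, R v w = fderiv ℝ Γ z v w - fderiv ℝ Γ z w v +
        (Γ z v ∘L Γ z w - Γ z w ∘L Γ z v)) ∧
      flatD Γ (flatD Γ b) z + flatD Γ (flatD Γ b) z =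
        alt₂ (ContinuousLinearMap.postcomp E (postcomp (b z)) ∘L R) := by
  have hdΓ : HasFDerivAt Γ (fderiv ℝ Γ z) z := (hΓ.differentiableAt (by simp)).hasFDerivAt
  have hdb : HasFDerivAt b (fderiv ℝ b z) z := (hb.differentiableAt (by simp)).hasFDerivAt
  have hddb : HasFDerivAt (fderiv ℝ b) (fderiv ℝ (fderiv ℝ b) z) z :=
    ((hb.fderiv_right (m := 1) (one_add_one_eq_two.trans_le two_le_infty)).differentiableAt
      one_ne_zero).hasFDerivAt
  have hsymm : ∀ v w, fderiv ℝ (fderiv ℝ b) z v w = fderiv ℝ (fderiv ℝ b) z w v := fun v w =>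
    (hb.isSymmSndFDerivAt (by simpa using two_le_infty)) v w
  let L : E → E →L[ℝ] E [⋀^Fin k]→L[ℝ] E := fun y => fderiv ℝ b y + postcomp (b y) ∘L Γ y
  obtain ⟨L', hL', hL'vw⟩ : ∃ L' : E →L[ℝ] E →L[ℝ] E [⋀^Fin k]→L[ℝ] E, HasFDerivAt L L' z ∧
      ∀ v w, L' v w = fderiv ℝ (fderiv ℝ b) z v w + (postcomp (b z) (fderiv ℝ Γ z v w) +
        postcomp (fderiv ℝ b z v) (Γ z w)) := by
    obtain ⟨B', hB', hB'vw⟩ := exists_hasFDerivAt_postcomp_comp hdΓ hdb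
    refine ⟨fderiv ℝ (fderiv ℝ b) z + B', hasFDerivAt_add (X := E)
      (Y := E →L[ℝ] E [⋀^Fin k]→L[ℝ] E) hddb hB', fun v w => ?_⟩
    rw [← hB'vw]
    rfl
  have hD : fderiv ℝ (flatD Γ b) z = alternatizeUncurryFinCLM ℝ E E ∘L L' :=
    (hasFDerivAt_clm_comp (X := E) (Y := E →L[ℝ] E [⋀^Fin k]→L[ℝ] E)
      (Z := E [⋀^Fin (k + 1)]→L[ℝ] E) _ hL').fderiv
  -- `X` is the contribution of the outer connection term, `Γ` composed with the inner derivative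
  -- before alternation; `L'` is that of the outer differentiation.
  let X : E →L[ℝ] E →L[ℝ] E [⋀^Fin k]→L[ℝ] E :=
    (ContinuousLinearMap.compContinuousAlternatingMapCLM ℝ E E E (Fin k)).bilinearComp (Γ z) (L z)
  have hX : ∀ v w, X v w = postcomp (L z w) (Γ z v) := fun v w => rfl
  have hXalt : alternatizeUncurryFinCLM ℝ E E ∘L X = postcomp (flatD Γ b z) ∘L Γ z := by
    ext v u : 2
    change alternatizeUncurryFin (X v) u = Γ z v (alternatizeUncurryFin (L z) u)
    simp only [ContinuousAlternatingMap.alternatizeUncurryFin_apply, map_sum, map_zsmul]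
    rfl
  let K₂ : E →L[ℝ] E →L[ℝ] E →L[ℝ] E :=
    (ContinuousLinearMap.compL ℝ E E E).bilinearComp (Γ z) (Γ z)
  let K : E →L[ℝ] E →L[ℝ] E →L[ℝ] E := fderiv ℝ Γ z + K₂
  have hK : ∀ v w, K v w = fderiv ℝ Γ z v w + Γ z v ∘L Γ z w := fun v w => rfl
  let PK : E →L[ℝ] E →L[ℝ] E [⋀^Fin k]→L[ℝ] E :=
    ContinuousLinearMap.postcomp E (postcomp (b z)) ∘L K
  have hPK : ∀ v w, PK v w = postcomp (b z) (K v w) := fun v w => rfl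
  have h1 : flatD Γ (flatD Γ b) z = alt₂ PK := by
    have h2 : flatD Γ (flatD Γ b) z = alt₂ (L' + X) := by
      rw [map_add]
      change alternatizeUncurryFin (fderiv ℝ (flatD Γ b) z + _) = alternatizeUncurryFin _ +
        alternatizeUncurryFin _
      rw [hXalt, hD, ContinuousAlternatingMap.alternatizeUncurryFin_add]
    rw [h2]
    -- Modulo symmetric terms only `PK` survives: the second derivative of `b` is symmetric, and the
    -- cross terms `Γ w ∘ b' v` and `Γ v ∘ b' w` add up to a symmetric map.
    refine alt₂_congr fun v w => ?_
    have hL : ∀ w, L z w = fderiv ℝ b z w + postcomp (b z) (Γ z w) := fun w => rfl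
    have hXu : ∀ v w u, postcomp (postcomp (b z) (Γ z w)) (Γ z v) u =
      postcomp (b z) (Γ z v ∘L Γ z w) u := fun v w u => rfl
    have hPu : ∀ v w u, postcomp (fderiv ℝ b z v + postcomp (b z) (Γ z v)) (Γ z w) u =
      postcomp (fderiv ℝ b z v) (Γ z w) u + postcomp (b z) (Γ z w ∘L Γ z v) u :=
      fun v w u => map_add (Γ z w) _ _
    ext1 u
    change L' v w u + X v w u + PK w v u = L' w v u + X w v u + PK v w u
    rw [hL'vw, hL'vw, hX, hX, hPK, hPK, hK, hK, hL, hL, hsymm v w]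
    simp only [map_add, ContinuousAlternatingMap.add_apply, hPu]
    abel
  -- The curvature is `K` antisymmetrised. The alternation has no normalising factor, so it counts
  -- `K` twice, whence the doubled left side.
  refine ⟨K - K.flip, fun v w => ?_, ?_⟩
  · change K v w - K w v = _
    rw [hK, hK]
    abel
  · rw [h1]
    have h3 : alt₂ (ContinuousLinearMap.postcomp E (postcomp (b z)) ∘L (K - K.flip) + PK.flip) =
        alt₂ PK := by
      congr 1
      ext v w : 2
      change postcomp (b z) (K v w - K w v) + postcomp (b z) (K w v) = postcomp (b z) (K v w)
      rw [map_sub, sub_add_cancel]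
    rw [map_add, alt₂_flip, ← sub_eq_add_neg, sub_eq_iff_eq_add] at h3
    exact h3.symm

/-- The curvature in a frame `e`. -/
theorem frame_curvature {Γ A : E → E →L[ℝ] E →L[ℝ] E} {e : E → E →L[ℝ] E} {z : E}
    (he : ContDiffAt ℝ ∞ e z) (hΓ : DifferentiableAt ℝ Γ z) (hA : DifferentiableAt ℝ A z)
    (h : ∀ᶠ y in 𝓝 z, ∀ v, fderiv ℝ e y v = e y ∘L A y v - Γ y v ∘L e y) (v w : E) :
    e z ∘L (fderiv ℝ A z v w - fderiv ℝ A z w v + (A z v ∘L A z w - A z w ∘L A z v)) =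
      (fderiv ℝ Γ z v w - fderiv ℝ Γ z w v + (Γ z v ∘L Γ z w - Γ z w ∘L Γ z v)) ∘L e z := by
  have hde : HasFDerivAt e (fderiv ℝ e z) z := (he.differentiableAt (by simp)).hasFDerivAt
  have hdde : HasFDerivAt (fderiv ℝ e) (fderiv ℝ (fderiv ℝ e) z) z :=
    ((he.fderiv_right (m := 1) (one_add_one_eq_two.trans_le two_le_infty)).differentiableAt
      one_ne_zero).hasFDerivAt
  have hsymm : ∀ v w, fderiv ℝ (fderiv ℝ e) z v w = fderiv ℝ (fderiv ℝ e) z w v := fun v w =>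
    (he.isSymmSndFDerivAt (by simpa using two_le_infty)) v w
  have hev : ∀ X : E → E →L[ℝ] E →L[ℝ] E, DifferentiableAt ℝ X z → ∀ w,
      HasFDerivAt (fun y => X y w) ((fderiv ℝ X z).flip w) z := fun X hX w =>
    (hX.hasFDerivAt.clm_apply (hasFDerivAt_const w z)).congr_fderiv (by ext; simp)
  -- Differentiate the equation `de = e A - Γ e` once more. Symmetry of the second derivative of `e`
  -- then equates the two orders, which is the curvature relation.
  have key : ∀ v w x, fderiv ℝ (fderiv ℝ e) z v w x =
      e z (fderiv ℝ A z v w x) + fderiv ℝ e z v (A z w x) -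
        (Γ z w (fderiv ℝ e z v x) + fderiv ℝ Γ z v w (e z x)) := by
    intro v w x
    have h1 : HasFDerivAt (fun y => fderiv ℝ e y w) ((fderiv ℝ (fderiv ℝ e) z).flip w) z :=
      hev (fderiv ℝ e) hdde.differentiableAt w
    have h2 := (hde.clm_comp (hev A hA w)).sub ((hev Γ hΓ w).clm_comp hde)
    have h3 := h1.unique (h2.congr_of_eventuallyEq (h.mono fun y hy => hy w))
    have h4 := congrArg (fun L : E →L[ℝ] E →L[ℝ] E => L v x) h3
    exact h4
  have h0 := h.self_of_nhds
  ext x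
  have h1 := key v w x
  rw [hsymm, key w v x, h0, h0] at h1
  have e1 : ∀ v w, (e z ∘L A z v - Γ z v ∘L e z) w = e z (A z v w) - Γ z v (e z w) :=
    fun v w => rfl
  simp only [e1, map_sub] at h1
  change e z (fderiv ℝ A z v w x - fderiv ℝ A z w v x + (A z v (A z w x) - A z w (A z v x))) =
    fderiv ℝ Γ z v w (e z x) - fderiv ℝ Γ z w v (e z x) +
      (Γ z v (Γ z w (e z x)) - Γ z w (Γ z v (e z x)))
  simp only [map_add, map_sub]
  rw [← sub_eq_zero] at h1 ⊢
  rw [← neg_eq_zero, ← h1]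
  abel

/-- Naturality of the curvature product under a change of frame: `R'` is `R` with its two arguments
and its endomorphism values all moved by `e` and its inverse. -/
theorem exists_transport_alt₂ {e f : E →L[ℝ] E} (hef : e ∘L f = ContinuousLinearMap.id ℝ E)
    (R : E →L[ℝ] E →L[ℝ] E →L[ℝ] E) :
    ∃ R' : E →L[ℝ] E →L[ℝ] E →L[ℝ] E, (∀ v w, R' v w = f ∘L R (e v) (e w) ∘L e) ∧
      ∀ {k : ℕ} (b : E [⋀^Fin k]→L[ℝ] E),
        transport f e (alt₂ (ContinuousLinearMap.postcomp E (postcomp b) ∘L R)) =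
          alt₂ (ContinuousLinearMap.postcomp E (postcomp (transport f e b)) ∘L R') := by
  let C : (E →L[ℝ] E) →L[ℝ] E →L[ℝ] E :=
    (ContinuousLinearMap.compL ℝ E E E f) ∘L ((ContinuousLinearMap.compL ℝ E E E).flip e)
  let R' : E →L[ℝ] E →L[ℝ] E →L[ℝ] E :=
    ContinuousLinearMap.postcomp E C ∘L R.bilinearComp e e
  have hR' : ∀ v w, R' v w = f ∘L R (e v) (e w) ∘L e := fun v w => rfl
  refine ⟨R', hR', fun b => ?_⟩
  change transport f e (alternatizeUncurryFin _) = alternatizeUncurryFin _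
  rw [← alternatize_transport]
  congr 1
  ext1 v
  change transport f e (alternatizeUncurryFin (postcomp b ∘L R (e v))) = alternatizeUncurryFin
    (postcomp (transport f e b) ∘L R' v)
  rw [← alternatize_transport]
  congr 1
  ext w u
  change f (R (e v) (e w) (b fun i => e (u i))) = f (R (e v) (e w) (e (f (b fun i => e (u i)))))
  have h : e (f (b fun i => e (u i))) = b fun i => e (u i) :=
    congrArg (fun L : E →L[ℝ] E => L _) hef
  rw [h]

end

section

variable {N : ℕ} {M : Type*} [TopologicalSpace M] [ChartedSpace (Eu N) M]

/-! ### Smooth frames -/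

theorem contMDiffAt_clm_of_apply {W : Type*} [NormedAddCommGroup W] [NormedSpace ℝ W]
    {g : M → Eu N →L[ℝ] W} {y : M} {n : WithTop ℕ∞}
    (h : ∀ v, ContMDiffAt (𝓡 N) 𝓘(ℝ, W) n (fun z => g z v) y) :
    ContMDiffAt (𝓡 N) 𝓘(ℝ, Eu N →L[ℝ] W) n g y := by
  have hg : ∀ z, g z = ∑ i, ContinuousLinearMap.smulRightL ℝ (Eu N) W (EuclideanSpace.proj i)
      (g z (EuclideanSpace.single i 1)) := by
    intro z
    ext v
    rw [_root_.sum_apply]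
    conv_lhs => rw [← (EuclideanSpace.basisFun (Fin N) ℝ).sum_repr v, map_sum]
    refine Finset.sum_congr rfl fun i _ => ?_
    rw [map_smul, EuclideanSpace.basisFun_apply, EuclideanSpace.basisFun_repr]
    rfl
  rw [funext hg]
  refine ContMDiffAt.sum fun i _ => ?_
  exact (ContinuousLinearMap.contMDiff
    (ContinuousLinearMap.smulRightL ℝ (Eu N) W (EuclideanSpace.proj i))).contMDiffAt.comp y (h _)

/-- The matrix of the frame `s` in the frame `F`. -/
def frameChange {y : M} (F s : Frame (N := N) y) : Eu N →L[ℝ] Eu N :=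
  (F.symm : TangentSpace (𝓡 N) y →L[ℝ] Eu N) ∘L (s : Eu N →L[ℝ] TangentSpace (𝓡 N) y)

theorem frameChange_apply {y : M} (F s : Frame (N := N) y) (w : Eu N) :
    frameChange F s w = F.symm (s w) := rfl

theorem apply_frameChange {y : M} (F s : Frame (N := N) y) (w : Eu N) :
    F (frameChange F s w) = s w := by
  rw [frameChange_apply, F.apply_symm_apply]

theorem frameChange_comp {y : M} (F s t : Frame (N := N) y) :
    frameChange F s ∘L frameChange s t = frameChange F t := by
  ext w : 1
  change F.symm (s (s.symm (t w))) = F.symm (t w)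
  rw [s.apply_symm_apply]

theorem frameChange_self {y : M} (s : Frame (N := N) y) :
    frameChange s s = ContinuousLinearMap.id ℝ (Eu N) := by
  ext w : 1
  exact s.symm_apply_apply w

theorem Frame.pull_push {y : M} (s : Frame (N := N) y) {k : ℕ} (a : VForm N k) :
    s.pull (s.push a) = a := by
  ext1 v
  change s.symm (s (a fun i => s.symm (s (v i)))) = a v
  simp

theorem Frame.push_pull {y : M} (s : Frame (N := N) y) {k : ℕ} (b : TForm (N := N) k y) :
    s.push (s.pull b) = b := by
  ext1 v
  change s (s.symm (b fun i => s (s.symm (v i)))) = b v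
  simp

theorem pull_eq_transport {y : M} (F s : Frame (N := N) y) {k : ℕ} (b : TForm (N := N) k y) :
    F.pull b = transport (frameChange F s) (frameChange s F) (s.pull b) := by
  ext1 v
  rw [transport_apply]
  change F.symm (b fun i => F (v i)) = F.symm (s (s.symm (b fun i => s (s.symm (F (v i))))))
  simp

theorem Frame.pull_sub {y : M} (s : Frame (N := N) y) {k : ℕ} (a b : TForm (N := N) k y) :
    s.pull (a - b) = s.pull a - s.pull b := by
  ext1 v
  exact map_sub s.symm _ _

theorem contMDiffAt_transport {E : Type*} [NormedAddCommGroup E] [NormedSpace ℝ E]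
    [FiniteDimensional ℝ E] {k : ℕ} {p q : M → E →L[ℝ] E} {b : M → E [⋀^Fin k]→L[ℝ] E} {y : M}
    {n : WithTop ℕ∞} (hp : ContMDiffAt (𝓡 N) 𝓘(ℝ, E →L[ℝ] E) n p y)
    (hq : ContMDiffAt (𝓡 N) 𝓘(ℝ, E →L[ℝ] E) n q y)
    (hb : ContMDiffAt (𝓡 N) 𝓘(ℝ, E [⋀^Fin k]→L[ℝ] E) n b y) :
    ContMDiffAt (𝓡 N) 𝓘(ℝ, E [⋀^Fin k]→L[ℝ] E) n (fun z => transport (p z) (q z) (b z)) y :=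
  contDiff_transport.contMDiff.contMDiffAt.comp y (hp.prodMk_space (hq.prodMk_space hb))

theorem contMDiffAt_inverse {g h : M → Eu N →L[ℝ] Eu N} {y : M}
    (hg : ContMDiffAt (𝓡 N) 𝓘(ℝ, Eu N →L[ℝ] Eu N) ∞ g y)
    (h₁ : ∀ z, g z ∘L h z = ContinuousLinearMap.id ℝ (Eu N))
    (h₂ : ∀ z, h z ∘L g z = ContinuousLinearMap.id ℝ (Eu N)) :
    ContMDiffAt (𝓡 N) 𝓘(ℝ, Eu N →L[ℝ] Eu N) ∞ h y := by
  let e : M → Eu N ≃L[ℝ] Eu N := fun z => ContinuousLinearEquiv.equivOfInverse (g z) (h z)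
    (fun v => congrArg (fun L : Eu N →L[ℝ] Eu N => L v) (h₂ z))
    (fun v => congrArg (fun L : Eu N →L[ℝ] Eu N => L v) (h₁ z))
  have he : h = fun z => ContinuousLinearMap.inverse (g z) := by
    funext z
    exact (ContinuousLinearMap.inverse_equiv (e z)).symm
  rw [he]
  have h3 : ContDiffAt ℝ ∞ ContinuousLinearMap.inverse (g y) :=
    contDiffAt_map_inverse (e y)
  exact h3.contMDiffAt.comp y hg

variable [IsManifold (𝓡 N) ∞ M]

/-- The family `s` of frames is smooth at `y`. -/
def SmoothFramesAt (s : ∀ x : M, Frame (N := N) x) (y : M) : Prop :=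
  ∀ w : Eu N, ContMDiffAt (𝓡 N) (𝓡 N).tangent ∞
    (fun x => (⟨x, s x w⟩ : TangentBundle (𝓡 N) M)) y

theorem SmoothFramesOn.smoothFramesAt {s : ∀ x : M, Frame (N := N) x} {U : Set M}
    (h : SmoothFramesOn s U) (hU : IsOpen U) {y : M} (hy : y ∈ U) : SmoothFramesAt s y :=
  fun w => (h w).contMDiffAt (hU.mem_nhds hy)

/-- The domain of the preferred chart at `x`. -/
def chartDom (x : M) : Set M :=
  (trivializationAt (Eu N) (TangentSpace (𝓡 N) : M → Type _) x).baseSet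

theorem isOpen_chartDom (x : M) : IsOpen (chartDom (N := N) x) := Trivialization.open_baseSet _

theorem mem_chartDom (x : M) : x ∈ chartDom (N := N) x := FiberBundle.mem_baseSet_trivializationAt' x

open Classical in
/-- The frames of the coordinate vector fields of the preferred chart at `x`, extended arbitrarily
outside its domain. -/
def chartFrame (x z : M) : Frame (N := N) z :=
  if h : z ∈ chartDom (N := N) x then
    ((trivializationAt (Eu N) (TangentSpace (𝓡 N) : M → Type _) x).continuousLinearEquivAt ℝ z
      h).symm
  else coordFrame z

theorem chartFrame_self (x : M) : chartFrame (N := N) x x = coordFrame x := dif_pos (mem_chartDom x)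

theorem chartFrame_of_mem {x z : M} (h : z ∈ chartDom (N := N) x) : chartFrame (N := N) x z =
    ((trivializationAt (Eu N) (TangentSpace (𝓡 N) : M → Type _) x).continuousLinearEquivAt ℝ z
      h).symm := dif_pos h

theorem chartFrame_apply {x z : M} (h : z ∈ chartDom (N := N) x) (w : Eu N) :
    chartFrame x z w = coordField x w z := by
  rw [chartFrame_of_mem h]
  exact congrFun (Trivialization.symm_continuousLinearEquivAt_eq (R := ℝ) _ h) w

theorem chartFrame_symm_apply {x z : M} (h : z ∈ chartDom (N := N) x)
    (v : TangentSpace (𝓡 N) z) : (chartFrame x z).symm v =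
      (trivializationAt (Eu N) (TangentSpace (𝓡 N) : M → Type _) x ⟨z, v⟩).2 := by
  rw [chartFrame_of_mem h]
  rfl

theorem inCoordinates_eq_pull {x z : M} (h : z ∈ chartDom (N := N) x) {k : ℕ}
    (b : TForm (N := N) k z) :
    ContinuousAlternatingMap.inCoordinates (Eu N) (Eu N)
        (E₁ := fun y : M => TangentSpace (𝓡 N) y) (E₂ := fun y : M => TangentSpace (𝓡 N) y)
        x z x z b = (chartFrame x z).pull b := by
  rw [chartFrame_of_mem h]
  exact ContinuousAlternatingMap.inCoordinates_eq (F₁ := Eu N) (F₂ := Eu N)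
    (E₁ := fun y : M => TangentSpace (𝓡 N) y) (E₂ := fun y : M => TangentSpace (𝓡 N) y) h h

theorem contMDiffAt_chartFrame_symm_iff {x y : M} (hy : y ∈ chartDom (N := N) x)
    {X : ∀ z : M, TangentSpace (𝓡 N) z} :
    ContMDiffAt (𝓡 N) (𝓡 N).tangent ∞ (fun z => (⟨z, X z⟩ : TangentBundle (𝓡 N) M)) y ↔
      ContMDiffAt (𝓡 N) 𝓘(ℝ, Eu N) ∞ (fun z => (chartFrame x z).symm (X z)) y := by
  refine ((trivializationAt (Eu N) (TangentSpace (𝓡 N) : M → Type _) x).contMDiffAt_section_iff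
    (IB := 𝓡 N) (n := ∞) hy).trans (Filter.EventuallyEq.contMDiffAt_iff ?_)
  filter_upwards [(isOpen_chartDom x).mem_nhds hy] with z hz
  rw [chartFrame_symm_apply hz]

theorem smoothFramesAt_chartFrame {x y : M} (hy : y ∈ chartDom (N := N) x) :
    SmoothFramesAt (chartFrame (N := N) x) y := fun w =>
  (contMDiffAt_chartFrame_symm_iff hy).2 (by
    simpa using! (contMDiffAt_const : ContMDiffAt (𝓡 N) 𝓘(ℝ, Eu N) ∞ (fun _ : M => w) y))

/-- Coordinates in `s` come from chart coordinates through the inverse of the smooth matrix of `s`,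
and inversion of matrices is smooth. -/
theorem contMDiffAt_frame_symm {s : ∀ x : M, Frame (N := N) x} {y : M} (hs : SmoothFramesAt s y)
    {X : ∀ z : M, TangentSpace (𝓡 N) z}
    (hX : ContMDiffAt (𝓡 N) (𝓡 N).tangent ∞ (fun z => (⟨z, X z⟩ : TangentBundle (𝓡 N) M)) y) :
    ContMDiffAt (𝓡 N) 𝓘(ℝ, Eu N) ∞ (fun z => (s z).symm (X z)) y := by
  have h1 : ContMDiffAt (𝓡 N) 𝓘(ℝ, Eu N →L[ℝ] Eu N) ∞
      (fun z => frameChange (chartFrame y z) (s z)) y :=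
    contMDiffAt_clm_of_apply fun v =>
      (contMDiffAt_chartFrame_symm_iff (mem_chartDom y)).1 (hs v)
  have h2 := contMDiffAt_inverse (h := fun z => frameChange (s z) (chartFrame y z)) h1
    (fun z => by rw [frameChange_comp, frameChange_self])
    (fun z => by rw [frameChange_comp, frameChange_self])
  have h3 := h2.clm_apply ((contMDiffAt_chartFrame_symm_iff (mem_chartDom y)).1 hX)
  refine h3.congr_of_eventuallyEq (Filter.Eventually.of_forall fun z => ?_)
  change _ = (s z).symm (chartFrame y z ((chartFrame y z).symm (X z)))
  rw [ContinuousLinearEquiv.apply_symm_apply]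

theorem contMDiffAt_frameChange {s t : ∀ x : M, Frame (N := N) x} {y : M}
    (hs : SmoothFramesAt s y) (ht : SmoothFramesAt t y) :
    ContMDiffAt (𝓡 N) 𝓘(ℝ, Eu N →L[ℝ] Eu N) ∞ (fun z => frameChange (s z) (t z)) y :=
  contMDiffAt_clm_of_apply fun v => contMDiffAt_frame_symm hs (ht v)

theorem contMDiffAt_pull_of_pull {s t : ∀ x : M, Frame (N := N) x} {y : M}
    (hs : SmoothFramesAt s y) (ht : SmoothFramesAt t y) {k : ℕ} {β : ∀ x : M, TForm (N := N) k x}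
    (h : ContMDiffAt (𝓡 N) 𝓘(ℝ, VForm N k) ∞ (fun z => (s z).pull (β z)) y) :
    ContMDiffAt (𝓡 N) 𝓘(ℝ, VForm N k) ∞ (fun z => (t z).pull (β z)) y := by
  rw [funext fun z => pull_eq_transport (t z) (s z) (β z)]
  exact contMDiffAt_transport (contMDiffAt_frameChange ht hs) (contMDiffAt_frameChange hs ht) h

/-- Smoothness of a form can be checked in a smooth frame. -/
theorem contMDiffAt_form_iff {s : ∀ x : M, Frame (N := N) x} {y : M}
    (hs : SmoothFramesAt s y) {k : ℕ} {β : ∀ x : M, TForm (N := N) k x} :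
    ContMDiffAt (𝓡 N) ((𝓡 N).prod 𝓘(ℝ, VForm N k)) ∞
      (fun x => TotalSpace.mk' (VForm N k) (E := fun x : M => TForm (N := N) k x) x (β x)) y ↔
    ContMDiffAt (𝓡 N) 𝓘(ℝ, VForm N k) ∞ (fun z => (s z).pull (β z)) y := by
  have hc := smoothFramesAt_chartFrame (mem_chartDom (N := N) y)
  refine (Bundle.contMDiffAt_section y).trans ⟨fun h => ?_, fun h => ?_⟩
  · refine contMDiffAt_pull_of_pull hc hs (h.congr_of_eventuallyEq ?_)
    filter_upwards [(isOpen_chartDom y).mem_nhds (mem_chartDom (N := N) y)] with z hz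
    exact (inCoordinates_eq_pull hz _).symm
  · refine (contMDiffAt_pull_of_pull hs hc h).congr_of_eventuallyEq ?_
    filter_upwards [(isOpen_chartDom y).mem_nhds (mem_chartDom (N := N) y)] with z hz
    exact inCoordinates_eq_pull hz _

end

section

variable {N : ℕ} {M : Type*} [TopologicalSpace M] [ChartedSpace (Eu N) M]

/-! ### Connection forms -/

section

variable {W W' : Type*} [NormedAddCommGroup W] [NormedSpace ℝ W] [NormedAddCommGroup W']
  [NormedSpace ℝ W']

theorem mvfderiv_hasFDerivAt_comp {g : M → W} {y : M} {Φ : W → W'} {D : W →L[ℝ] W'}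
    (hΦ : HasFDerivAt Φ D (g y)) (hg : MDifferentiableAt (𝓡 N) 𝓘(ℝ, W) g y) :
    mvfderiv (𝓡 N) (fun z => Φ (g z)) y = D ∘L mvfderiv (𝓡 N) g y := by
  have h : HasMFDerivAt (𝓡 N) 𝓘(ℝ, W') (Φ ∘ g) y _ :=
    HasMFDerivAt.comp y hΦ.hasMFDerivAt hg.hasMFDerivAt
  ext v
  exact congrArg (fun L => L v) h.mfderiv

theorem mvfderiv_prodMk {g : M → W} {g' : M → W'} {y : M}
    (hg : MDifferentiableAt (𝓡 N) 𝓘(ℝ, W) g y) (hg' : MDifferentiableAt (𝓡 N) 𝓘(ℝ, W') g' y)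
    (v : TangentSpace (𝓡 N) y) :
    mvfderiv (𝓡 N) (fun z => (g z, g' z)) y v = (mvfderiv (𝓡 N) g y v, mvfderiv (𝓡 N) g' y v) := by
  have h : MDifferentiableAt (𝓡 N) 𝓘(ℝ, W × W') (fun z => (g z, g' z)) y := hg.prodMk_space hg'
  refine Prod.ext ?_ ?_
  · exact (congrArg (fun L => L v) (mvfderiv_hasFDerivAt_comp
      (ContinuousLinearMap.fst ℝ W W').hasFDerivAt h)).symm
  · exact (congrArg (fun L => L v) (mvfderiv_hasFDerivAt_comp
      (ContinuousLinearMap.snd ℝ W W').hasFDerivAt h)).symm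

theorem mvfderiv_congr {g g' : M → W} {y : M} (h : g =ᶠ[𝓝 y] g') :
    mvfderiv (𝓡 N) g y = mvfderiv (𝓡 N) g' y := by
  ext v
  exact congrArg (fun L : Eu N →L[ℝ] W => L v) h.mfderiv_eq

end

theorem Frame.apply_eq_sum {y : M} (s : Frame (N := N) y) (w : Eu N) :
    s w = ∑ i, w i • s (EuclideanSpace.single i 1) := by
  conv_lhs => rw [← (EuclideanSpace.basisFun (Fin N) ℝ).sum_repr w, map_sum]
  refine Finset.sum_congr rfl fun i _ => ?_
  rw [map_smul, EuclideanSpace.basisFun_apply, EuclideanSpace.basisFun_repr]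

theorem mvfderiv_clm_apply {W W' : Type*} [NormedAddCommGroup W] [NormedSpace ℝ W]
    [NormedAddCommGroup W'] [NormedSpace ℝ W'] {g : M → W →L[ℝ] W'} {y : M}
    (hg : MDifferentiableAt (𝓡 N) 𝓘(ℝ, W →L[ℝ] W') g y) (w : W) (v : TangentSpace (𝓡 N) y) :
    mvfderiv (𝓡 N) (fun z => g z w) y v = mvfderiv (𝓡 N) g y v w :=
  congrArg (fun L => L v) (mvfderiv_hasFDerivAt_comp
    (ContinuousLinearMap.apply ℝ W' w).hasFDerivAt hg)

variable [IsManifold (𝓡 N) ∞ M]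

theorem cov_sum (cov : CovariantDerivative (𝓡 N) (Eu N) (TangentSpace (𝓡 N) : M → Type _))
    {ι : Type*} (S : Finset ι) {X : ι → ∀ z : M, TangentSpace (𝓡 N) z} {y : M}
    (hX : ∀ i, MDifferentiableAt (𝓡 N) (𝓡 N).tangent
      (fun z => (⟨z, X i z⟩ : TangentBundle (𝓡 N) M)) y) :
    cov (fun z => ∑ i ∈ S, X i z) y = ∑ i ∈ S, cov (X i) y := by
  classical
  induction S using Finset.induction_on with
  | empty =>
    simp only [Finset.sum_empty]
    exact congrFun cov.zero y
  | insert i S hi ih =>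
    simp only [Finset.sum_insert hi]
    rw [← ih]
    exact cov.isCovariantDerivativeOn.add (hX i) (MDifferentiableAt.sum_section fun j _ => hX j)

/-- The connection form of a covariant derivative in the frame `s`. -/
def frameConn (cov : CovariantDerivative (𝓡 N) (Eu N) (TangentSpace (𝓡 N) : M → Type _))
    (s : ∀ x : M, Frame (N := N) x) (y : M) : Eu N →L[ℝ] Eu N →L[ℝ] Eu N :=
  ∑ i, ContinuousLinearMap.smulRightL ℝ (Eu N) (Eu N) (EuclideanSpace.proj i) ∘L
    ((s y).symm : TangentSpace (𝓡 N) y →L[ℝ] Eu N) ∘L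
      cov (fun z => s z (EuclideanSpace.single i 1)) y ∘L
        (s y : Eu N →L[ℝ] TangentSpace (𝓡 N) y)

theorem frameConn_apply (cov : CovariantDerivative (𝓡 N) (Eu N) (TangentSpace (𝓡 N) : M → Type _))
    (s : ∀ x : M, Frame (N := N) x) (y : M) (v w : Eu N) :
    frameConn cov s y v w =
      ∑ i, w i • (s y).symm (cov (fun z => s z (EuclideanSpace.single i 1)) y (s y v)) := by
  rw [frameConn, _root_.sum_apply, _root_.sum_apply]
  rfl

/-- The Leibniz rule in a frame. -/
theorem cov_frame_apply (cov : CovariantDerivative (𝓡 N) (Eu N) (TangentSpace (𝓡 N) : M → Type _))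
    {s : ∀ x : M, Frame (N := N) x} {y : M} (hs : SmoothFramesAt s y) {g : M → Eu N}
    (hg : MDifferentiableAt (𝓡 N) 𝓘(ℝ, Eu N) g y) (v : TangentSpace (𝓡 N) y) :
    cov (fun z => s z (g z)) y v =
      s y (mvfderiv (𝓡 N) g y v + frameConn cov s y ((s y).symm v) (g y)) := by
  have hgi : ∀ i, MDifferentiableAt (𝓡 N) 𝓘(ℝ, ℝ) (fun z => g z i) y := fun i =>
    (EuclideanSpace.proj i : Eu N →L[ℝ] ℝ).mdifferentiableAt.comp y hg
  have hdi : ∀ i, mvfderiv (𝓡 N) (fun z => g z i) y v = mvfderiv (𝓡 N) g y v i := fun i =>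
    congrArg (fun L => L v) (mvfderiv_hasFDerivAt_comp
      (EuclideanSpace.proj i : Eu N →L[ℝ] ℝ).hasFDerivAt hg)
  have hsi : ∀ i : Fin N, MDifferentiableAt (𝓡 N) (𝓡 N).tangent
      (fun z => (⟨z, s z (EuclideanSpace.single i 1)⟩ : TangentBundle (𝓡 N) M)) y := fun i =>
    (hs _).mdifferentiableAt (by simp)
  have h1 : (fun z => s z (g z)) = fun z => ∑ i, g z i • s z (EuclideanSpace.single i 1) :=
    funext fun z => (s z).apply_eq_sum (g z)
  rw [h1, cov_sum cov Finset.univ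
    (X := fun i z => g z i • s z (EuclideanSpace.single i 1)) fun i =>
      MDifferentiableAt.smul_section (hgi i) (hsi i),
    _root_.sum_apply, map_add, (s y).apply_eq_sum (mvfderiv (𝓡 N) g y v), frameConn_apply, map_sum,
    ← Finset.sum_add_distrib]
  refine Finset.sum_congr rfl fun i _ => ?_
  have h2 := congrArg (fun L => L v)
    (cov.isCovariantDerivativeOn (s := Set.univ).leibniz (hsi i) (hgi i))
  refine h2.trans ?_
  change g y i • cov _ y v + mvfderiv (𝓡 N) (fun z => g z i) y v • _ = _
  rw [hdi, map_smul, ContinuousLinearEquiv.apply_symm_apply, ContinuousLinearEquiv.apply_symm_apply,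
    add_comm]

theorem cov_frame (cov : CovariantDerivative (𝓡 N) (Eu N) (TangentSpace (𝓡 N) : M → Type _))
    {s : ∀ x : M, Frame (N := N) x} {y : M} (hs : SmoothFramesAt s y) (v w : Eu N) :
    cov (fun z => s z w) y (s y v) = s y (frameConn cov s y v w) := by
  have h := cov_frame_apply cov hs (g := fun _ => w) mdifferentiableAt_const (s y v)
  rw [h, mvfderiv_const, ContinuousLinearEquiv.symm_apply_apply]
  congr 1
  exact zero_add _

/-- The derivative of a change of frames. -/
theorem mvfderiv_frameChange
    (cov : CovariantDerivative (𝓡 N) (Eu N) (TangentSpace (𝓡 N) : M → Type _))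
    {F s : ∀ x : M, Frame (N := N) x} {y : M} (hF : SmoothFramesAt F y) (hs : SmoothFramesAt s y)
    (v : Eu N) :
    mvfderiv (𝓡 N) (fun z => frameChange (F z) (s z)) y (F y v) =
      frameChange (F y) (s y) ∘L frameConn cov s y (frameChange (s y) (F y) v) -
        frameConn cov F y v ∘L frameChange (F y) (s y) := by
  have he := (contMDiffAt_frameChange hF hs).mdifferentiableAt (by simp)
  ext1 w
  -- The derivative of `s w` is computed twice: by Leibniz from its coordinates in `F`, then by the
  -- connection form of `s`.
  have h1 := cov_frame_apply cov hF (g := fun z => frameChange (F z) (s z) w)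
    (((contMDiffAt_frameChange hF hs).clm_apply contMDiffAt_const).mdifferentiableAt (by simp))
    (F y v)
  simp only [apply_frameChange] at h1
  have h2 := cov_frame cov hs (frameChange (s y) (F y) v) w
  rw [apply_frameChange, h1, ← apply_frameChange (F y) (s y)] at h2
  have h3 := (F y).injective h2
  rw [ContinuousLinearEquiv.symm_apply_apply, mvfderiv_clm_apply he] at h3
  exact eq_sub_of_add_eq h3

theorem contMDiffAt_frameConn [T2Space M]
    {cov : CovariantDerivative (𝓡 N) (Eu N) (TangentSpace (𝓡 N) : M → Type _)}
    (hcov : cov.ContMDiffCovariantDerivative ∞)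
    {s : ∀ x : M, Frame (N := N) x} {U : Set M} (hU : IsOpen U) (hs : SmoothFramesOn s U)
    {y : M} (hy : y ∈ U) :
    ContMDiffAt (𝓡 N) 𝓘(ℝ, Eu N →L[ℝ] Eu N →L[ℝ] Eu N) ∞ (frameConn cov s) y := by
  refine contMDiffAt_clm_of_apply fun v => contMDiffAt_clm_of_apply fun w => ?_
  -- Smoothness of the connection is applied to global sections, so the local field `s w` is cut off
  -- by a bump function supported in `U`.
  obtain ⟨ψ, -, hψ⟩ := (SmoothBumpFunction.nhds_basis_tsupport (I := 𝓡 N) y).mem_iff.1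
    (hU.mem_nhds hy)
  let σ : ∀ z : M, TangentSpace (𝓡 N) z := fun z => ψ z • s z w
  have hσ : ContMDiff (𝓡 N) (𝓡 N).tangent ∞ (fun z => (⟨z, σ z⟩ : TangentBundle (𝓡 N) M)) :=
    ContMDiffOn.smul_section_of_tsupport ψ.contMDiff.contMDiffOn hU hψ (hs w)
  have h1 := (hcov.contMDiff.contMDiff (σ := σ) hσ.contMDiffOn).contMDiffAt Filter.univ_mem
    (x := y)
  have h2 := contMDiffAt_frame_symm (hs.smoothFramesAt hU hy)
    (ContMDiffAt.clm_bundle_apply h1 (hs.smoothFramesAt hU hy v))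
  refine h2.congr_of_eventuallyEq ?_
  -- Locality of the connection at `z` needs `ψ = 1` on a neighbourhood of each `z` near `y`, not
  -- just at `z`.
  have h3 : ∀ᶠ z in 𝓝 y, ∀ᶠ z' in 𝓝 z, ψ z' = 1 := eventually_eventually_nhds.2 ψ.eventuallyEq_one
  filter_upwards [h3, hU.mem_nhds hy] with z hz hzU
  have hsz := hs.smoothFramesAt hU hzU
  have h4 : cov σ z = cov (fun z => s z w) z := by
    refine cov.isCovariantDerivativeOn.congr_of_eventuallyEq (s := Set.univ)
      ((hσ z).mdifferentiableAt (by simp)) ((hsz w).mdifferentiableAt (by simp)) Filter.univ_mem ?_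
    filter_upwards [hz] with z' hz'
    change ψ z' • _ = _
    rw [hz', one_smul]
  rw [h4, cov_frame cov hsz, ContinuousLinearEquiv.symm_apply_apply]

end

section

variable {N : ℕ} {M : Type*} [TopologicalSpace M] [ChartedSpace (Eu N) M]

/-! ### The covariant exterior derivative in a frame -/

theorem frameChange_frameChange {y : M} (F s : Frame (N := N) y) (w : Eu N) :
    frameChange F s (frameChange s F w) = w := by
  rw [frameChange_apply, apply_frameChange, F.symm_apply_apply]

theorem mvfderiv_transport {E : Type*} [NormedAddCommGroup E] [NormedSpace ℝ E] {k : ℕ}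
    {p q : M → E →L[ℝ] E} {b : M → E [⋀^Fin k]→L[ℝ] E} {y : M}
    (hp : MDifferentiableAt (𝓡 N) 𝓘(ℝ, E →L[ℝ] E) p y)
    (hq : MDifferentiableAt (𝓡 N) 𝓘(ℝ, E →L[ℝ] E) q y)
    (hb : MDifferentiableAt (𝓡 N) 𝓘(ℝ, E [⋀^Fin k]→L[ℝ] E) b y) (v : TangentSpace (𝓡 N) y) :
    mvfderiv (𝓡 N) (fun z => transport (p z) (q z) (b z)) y v =
      transportDeriv (p y) (q y) (b y) (mvfderiv (𝓡 N) p y v) (mvfderiv (𝓡 N) q y v)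
        (mvfderiv (𝓡 N) b y v) := by
  obtain ⟨D, hD, hD'⟩ := exists_hasFDerivAt_transport (p y) (q y) (b y)
  have h := congrArg (fun L => L v) (mvfderiv_hasFDerivAt_comp (g := fun z => (p z, q z, b z)) hD
    (hp.prodMk_space (hq.prodMk_space hb)))
  refine h.trans ?_
  rw [← hD', ← mvfderiv_prodMk hq hb, ← mvfderiv_prodMk hp (hq.prodMk_space hb)]
  rfl

variable [IsManifold (𝓡 N) ∞ M]

/-- The covariant derivative of a form in the frame `s`. -/
def frameDeriv (cov : CovariantDerivative (𝓡 N) (Eu N) (TangentSpace (𝓡 N) : M → Type _))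
    (s : ∀ x : M, Frame (N := N) x) {k : ℕ} (β : ∀ x : M, TForm (N := N) k x) (y : M) :
    Eu N →L[ℝ] VForm N k :=
  mvfderiv (𝓡 N) (fun z => (s z).pull (β z)) y ∘L (s y : Eu N →L[ℝ] TangentSpace (𝓡 N) y) +
    act ((s y).pull (β y)) ∘L frameConn cov s y

theorem frameDeriv_apply
    (cov : CovariantDerivative (𝓡 N) (Eu N) (TangentSpace (𝓡 N) : M → Type _))
    (s : ∀ x : M, Frame (N := N) x) {k : ℕ} (β : ∀ x : M, TForm (N := N) k x) (y : M) (v : Eu N) :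
    frameDeriv cov s β y v = mvfderiv (𝓡 N) (fun z => (s z).pull (β z)) y (s y v) +
      act ((s y).pull (β y)) (frameConn cov s y v) := rfl

/-- The covariant derivative of a form does not depend on the frame. -/
theorem frameDeriv_eq_transport
    (cov : CovariantDerivative (𝓡 N) (Eu N) (TangentSpace (𝓡 N) : M → Type _))
    {F s : ∀ x : M, Frame (N := N) x} {y : M} (hF : SmoothFramesAt F y) (hs : SmoothFramesAt s y)
    {k : ℕ} {β : ∀ x : M, TForm (N := N) k x}
    (hβ : ContMDiffAt (𝓡 N) 𝓘(ℝ, VForm N k) ∞ (fun z => (s z).pull (β z)) y) :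
    frameDeriv cov F β y = transport (frameChange (F y) (s y)) (frameChange (s y) (F y)) ∘L
      frameDeriv cov s β y ∘L frameChange (s y) (F y) := by
  ext1 v
  have he := (contMDiffAt_frameChange hF hs).mdifferentiableAt (by simp)
  have hf := (contMDiffAt_frameChange hs hF).mdifferentiableAt (by simp)
  have h1 := mvfderiv_transport (E := Eu N) he hf (hβ.mdifferentiableAt (by simp)) (F y v)
  -- The inverse matrix is again a change of frames, so its derivative comes from the same formula
  -- with the roles of `F` and `s` exchanged.
  have h2 := mvfderiv_frameChange cov hs hF (frameChange (s y) (F y) v)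
  rw [apply_frameChange, frameChange_frameChange] at h2
  rw [mvfderiv_frameChange cov hF hs, h2] at h1
  change _ = transport (frameChange (F y) (s y)) (frameChange (s y) (F y))
    (frameDeriv cov s β y (frameChange (s y) (F y) v))
  rw [frameDeriv_apply, frameDeriv_apply, apply_frameChange,
    ← transportDeriv_add_act (E := Eu N), ← h1, ← pull_eq_transport]
  congr 3
  funext z
  exact pull_eq_transport _ _ _

theorem alternatize_frameDeriv
    (cov : CovariantDerivative (𝓡 N) (Eu N) (TangentSpace (𝓡 N) : M → Type _))
    {F s : ∀ x : M, Frame (N := N) x} {y : M} (hF : SmoothFramesAt F y) (hs : SmoothFramesAt s y)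
    {k : ℕ} {β : ∀ x : M, TForm (N := N) k x}
    (hβ : ContMDiffAt (𝓡 N) 𝓘(ℝ, VForm N k) ∞ (fun z => (s z).pull (β z)) y) :
    alternatizeUncurryFin (frameDeriv cov F β y) =
      transport (frameChange (F y) (s y)) (frameChange (s y) (F y))
        (alternatizeUncurryFin (frameDeriv cov s β y)) := by
  rw [frameDeriv_eq_transport cov hF hs hβ, alternatize_transport (E := Eu N)]

/-! ### Charts -/

theorem mfderiv_extChartAt {x y : M} (hy : y ∈ chartDom (N := N) x) :
    (mfderiv (𝓡 N) 𝓘(ℝ, Eu N) (extChartAt (𝓡 N) x) y : TangentSpace (𝓡 N) y →L[ℝ] Eu N) =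
      (chartFrame (N := N) x y).symm.toContinuousLinearMap := by
  rw [← TangentBundle.continuousLinearMapAt_trivializationAt (I := 𝓡 N) hy, chartFrame_of_mem hy]
  ext1 v
  exact (congrFun (Trivialization.coe_continuousLinearEquivAt_eq (R := ℝ)
    (trivializationAt (Eu N) (TangentSpace (𝓡 N) : M → Type _) x) hy) v).symm

/-- Coordinate fields are pullbacks by the chart of constant fields, which commute. -/
theorem mlieBracket_chartFrame {x y : M} (hy : y ∈ chartDom (N := N) x) (v w : Eu N) :
    VectorField.mlieBracket (𝓡 N) (fun z => chartFrame x z v) (fun z => chartFrame x z w) y = 0 := by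
  have : IsManifold (𝓡 N) (minSmoothness ℝ 2) M := by
    rw [minSmoothness_of_isRCLikeNormedField]
    infer_instance
  have h1 : ∀ v : Eu N, (fun z => chartFrame x z v : ∀ z : M, TangentSpace (𝓡 N) z) =ᶠ[𝓝 y]
      VectorField.mpullback (𝓡 N) 𝓘(ℝ, Eu N) (extChartAt (𝓡 N) x) (fun _ => v) := by
    intro v
    filter_upwards [(isOpen_chartDom x).mem_nhds hy] with z hz
    have h2 := ContinuousLinearMap.inverse_equiv (chartFrame (N := N) x z).symm
    rw [← mfderiv_extChartAt hz] at h2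
    exact (congrArg (fun L : Eu N →L[ℝ] TangentSpace (𝓡 N) z => L v) h2).symm
  have hc : ∀ v : Eu N, MDifferentiableAt 𝓘(ℝ, Eu N) 𝓘(ℝ, Eu N).tangent
      (fun z : Eu N => (⟨z, v⟩ : TangentBundle 𝓘(ℝ, Eu N) (Eu N))) (extChartAt (𝓡 N) x y) :=
    fun v => (contMDiffAt_vectorSpace_iff_contDiffAt.2
      (contDiffAt_const (c := v) (n := 1))).mdifferentiableAt one_ne_zero
  rw [(h1 v).mlieBracket_vectorField_eq (h1 w), ← VectorField.mpullback_mlieBracket (n := ∞)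
    (hc v) (hc w) (contMDiffAt_extChartAt' hy) (by simpa using two_le_infty),
    VectorField.mpullback_apply]
  have h0 : VectorField.mlieBracket 𝓘(ℝ, Eu N) (fun _ : Eu N => v) (fun _ : Eu N => w)
      (extChartAt (𝓡 N) x y) = 0 := by
    refine (congrFun (VectorField.mlieBracketWithin_eq_lieBracketWithin (𝕜 := ℝ) (E := Eu N)
      (V := fun _ => v) (W := fun _ => w) (s := Set.univ)) _).trans ?_
    simp only [VectorField.lieBracketWithin, fderivWithin_const_apply, zero_apply, sub_self]
    rfl
  rw [h0, map_zero]

/-- The Christoffel symbols of a torsion-free connection are symmetric. -/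
theorem frameConn_chartFrame_symm
    {cov : CovariantDerivative (𝓡 N) (Eu N) (TangentSpace (𝓡 N) : M → Type _)}
    (hcov : cov.torsion = 0) {x y : M} (hy : y ∈ chartDom (N := N) x) (v w : Eu N) :
    frameConn cov (chartFrame x) y v w = frameConn cov (chartFrame x) y w v := by
  have hs := smoothFramesAt_chartFrame hy
  have h := cov.torsion_eq_zero_iff.1 hcov ((hs v).mdifferentiableAt (by simp))
    ((hs w).mdifferentiableAt (by simp))
  rw [mlieBracket_chartFrame hy, cov_frame cov hs, cov_frame cov hs, sub_eq_zero] at h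
  exact (chartFrame x y).injective h

theorem connForm_eq_frameConn
    (cov : CovariantDerivative (𝓡 N) (Eu N) (TangentSpace (𝓡 N) : M → Type _)) (x : M)
    (v w : Eu N) : connForm cov x w v = frameConn cov (chartFrame x) x v w := by
  have hs := smoothFramesAt_chartFrame (mem_chartDom (N := N) x)
  have h : cov (coordField x w) x = cov (fun z => chartFrame x z w) x := by
    refine cov.isCovariantDerivativeOn.congr_of_eventuallyEq (s := Set.univ)
      (mdifferentiableAt_coordField x w) ((hs w).mdifferentiableAt (by simp)) Filter.univ_mem ?_
    filter_upwards [(isOpen_chartDom x).mem_nhds (mem_chartDom (N := N) x)] with z hz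
    exact (chartFrame_apply hz w).symm
  change (coordFrame x).symm (cov (coordField x w) x (coordFrame x v)) = _
  rw [h, ← chartFrame_self, cov_frame cov hs, ContinuousLinearEquiv.symm_apply_apply]

/-- The covariant exterior derivative of a torsion-free connection in an arbitrary frame. -/
theorem pull_covExtDeriv
    {cov : CovariantDerivative (𝓡 N) (Eu N) (TangentSpace (𝓡 N) : M → Type _)}
    (hcov : cov.torsion = 0) {s : ∀ x : M, Frame (N := N) x} {y : M} (hs : SmoothFramesAt s y)
    {k : ℕ} {β : ∀ x : M, TForm (N := N) k x}
    (hβ : ContMDiffAt (𝓡 N) 𝓘(ℝ, VForm N k) ∞ (fun z => (s z).pull (β z)) y) :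
    (s y).pull (covExtDeriv cov β y) = alternatizeUncurryFin (frameDeriv cov s β y) := by
  have hc := smoothFramesAt_chartFrame (mem_chartDom (N := N) y)
  have h1 : (chartFrame y y).pull (covExtDeriv cov β y) =
      alternatizeUncurryFin (frameDeriv cov (chartFrame y) β y) := by
    rw [covExtDeriv, ← chartFrame_self, Frame.pull_push]
    have h2 : (connForm cov y).flip = frameConn cov (chartFrame y) y := by
      ext1 v
      ext1 w
      exact connForm_eq_frameConn cov y v w
    have h3 : mvfderiv (𝓡 N) (fun z : M => ContinuousAlternatingMap.inCoordinates (Eu N) (Eu N)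
        (E₁ := fun y : M => TangentSpace (𝓡 N) y) (E₂ := fun y : M => TangentSpace (𝓡 N) y)
        y z y z (β z)) y = mvfderiv (𝓡 N) (fun z => (chartFrame y z).pull (β z)) y := by
      refine mvfderiv_congr ?_
      filter_upwards [(isOpen_chartDom y).mem_nhds (mem_chartDom (N := N) y)] with z hz
      exact inCoordinates_eq_pull hz _
    -- The definition contains only the action on values; symmetry of the Christoffel symbols allows
    -- the full action to replace it. The full expression, unlike the other, is natural in the
    -- frame.
    rw [h2, h3, frameDeriv, ContinuousAlternatingMap.alternatizeUncurryFin_add,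
      ContinuousAlternatingMap.alternatizeUncurryFin_add,
      alternatize_act_of_symmetric (E := Eu N) _
        (frameConn_chartFrame_symm hcov (mem_chartDom (N := N) y))]
    rfl
  rw [pull_eq_transport (s y) (chartFrame y y), h1, alternatize_frameDeriv cov hs hc
    (contMDiffAt_pull_of_pull hs hc hβ)]

end

section

/-! ### The covariant exterior derivative in a chart -/

section

variable {E : Type*} [NormedAddCommGroup E] [NormedSpace ℝ E]

theorem contDiffAt_clm_comp {X Y Z : Type*} [NormedAddCommGroup X] [NormedSpace ℝ X]
    [NormedAddCommGroup Y] [NormedSpace ℝ Y] [NormedAddCommGroup Z] [NormedSpace ℝ Z]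
    (P : Y →L[ℝ] Z) {f : X → Y} {x : X} {n : WithTop ℕ∞} (hf : ContDiffAt ℝ n f x) :
    ContDiffAt ℝ n (fun y => P (f y)) x := P.contDiff.contDiffAt.comp x hf

theorem contDiffAt_add {X Y : Type*} [NormedAddCommGroup X] [NormedSpace ℝ X]
    [NormedAddCommGroup Y] [NormedSpace ℝ Y] {f g : X → Y} {x : X} {n : WithTop ℕ∞}
    (hf : ContDiffAt ℝ n f x) (hg : ContDiffAt ℝ n g x) :
    ContDiffAt ℝ n (fun y => f y + g y) x := hf.add hg

theorem contDiffAt_flatD {k : ℕ} {Γ : E → E →L[ℝ] E →L[ℝ] E} {b : E → E [⋀^Fin k]→L[ℝ] E}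
    {z : E} (hΓ : ContDiffAt ℝ ∞ Γ z) (hb : ContDiffAt ℝ ∞ b z) :
    ContDiffAt ℝ ∞ (flatD Γ b) z := by
  have h1 : ContDiffAt ℝ ∞ (fderiv ℝ b) z := hb.fderiv_right (by simp)
  have h2 : ContDiffAt ℝ ∞ (fun y => postcomp (b y)) z :=
    contDiffAt_clm_comp (X := E) (Y := E [⋀^Fin k]→L[ℝ] E)
      (Z := (E →L[ℝ] E) →L[ℝ] E [⋀^Fin k]→L[ℝ] E)
      (ContinuousLinearMap.compContinuousAlternatingMapCLM ℝ E E E (Fin k)).flip hb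
  exact contDiffAt_clm_comp (X := E) (Y := E →L[ℝ] E [⋀^Fin k]→L[ℝ] E)
    (Z := E [⋀^Fin (k + 1)]→L[ℝ] E) (alternatizeUncurryFinCLM ℝ E E)
    (contDiffAt_add (X := E) (Y := E →L[ℝ] E [⋀^Fin k]→L[ℝ] E) h1 (h2.clm_comp hΓ))

theorem flatD_congr {k : ℕ} (Γ : E → E →L[ℝ] E →L[ℝ] E) {b b' : E → E [⋀^Fin k]→L[ℝ] E}
    {z : E} (h : b =ᶠ[𝓝 z] b') : flatD Γ b z = flatD Γ b' z := by
  rw [flatD, flatD, h.fderiv_eq, h.self_of_nhds]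

/-- The first Bianchi identity. -/
theorem bianchi_of_symmetric {Γ : E → E →L[ℝ] E →L[ℝ] E} {z : E} (hΓ : DifferentiableAt ℝ Γ z)
    (hsymm : ∀ᶠ y in 𝓝 z, ∀ v w, Γ y v w = Γ y w v) {R : E →L[ℝ] E →L[ℝ] E →L[ℝ] E}
    (hR : ∀ v w, R v w = fderiv ℝ Γ z v w - fderiv ℝ Γ z w v +
        (Γ z v ∘L Γ z w - Γ z w ∘L Γ z v)) (u v w : E) :
    R u v w + R v w u + R w u v = 0 := by
  have hev : ∀ v w, HasFDerivAt (fun y => Γ y v w) (((fderiv ℝ Γ z).flip v).flip w) z :=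
    fun v w => ((hΓ.hasFDerivAt.clm_apply (hasFDerivAt_const v z)).clm_apply
      (hasFDerivAt_const w z)).congr_fderiv (by ext; simp)
  -- Symmetry holds near `z`, so it passes to the derivative of `Γ`; all terms of the cyclic sum
  -- then cancel in pairs.
  have hd : ∀ u v w, fderiv ℝ Γ z u v w = fderiv ℝ Γ z u w v := fun u v w =>
    congrArg (fun L : E →L[ℝ] E => L u) ((hev v w).unique ((hev w v).congr_of_eventuallyEq
      (hsymm.mono fun y hy => hy v w)))
  have hs := hsymm.self_of_nhds
  have hR' : ∀ u v w, R u v w = fderiv ℝ Γ z u v w - fderiv ℝ Γ z v u w +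
      (Γ z u (Γ z v w) - Γ z v (Γ z u w)) := fun u v w => by rw [hR]; rfl
  rw [hR', hR', hR', hd u w v, hd v w u, hd w v u, hs w v, hs w u, hs v u]
  abel

end

variable {N : ℕ} {M : Type*} [TopologicalSpace M] [ChartedSpace (Eu N) M]
  [IsManifold (𝓡 N) ∞ M]

/-! ### Functions on the manifold read in a chart -/

section

variable {W : Type*}

/-- A function on a manifold, written in the preferred chart at `x`. -/
def inChart (x : M) (g : M → W) (z : Eu N) : W := g ((extChartAt (𝓡 N) x).symm z)

theorem inChart_apply {x y : M} (hy : y ∈ chartDom (N := N) x) (g : M → W) :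
    inChart x g (extChartAt (𝓡 N) x y) = g y := by
  rw [inChart, (extChartAt (𝓡 N) x).left_inv (by rwa [extChartAt_source])]

theorem extChartAt_mem_target {x y : M} (hy : y ∈ chartDom (N := N) x) :
    extChartAt (𝓡 N) x y ∈ (extChartAt (𝓡 N) x).target :=
  (extChartAt (𝓡 N) x).map_source (by rwa [extChartAt_source])

/-- A property that holds near `y` holds in the chart. -/
theorem eventually_inChart {x y : M} (hy : y ∈ chartDom (N := N) x) {p : M → Prop}
    (hp : ∀ᶠ z in 𝓝 y, p z) : ∀ᶠ z in 𝓝 (extChartAt (𝓡 N) x y),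
      p ((extChartAt (𝓡 N) x).symm z) ∧ (extChartAt (𝓡 N) x).symm z ∈ chartDom (N := N) x ∧
      extChartAt (𝓡 N) x ((extChartAt (𝓡 N) x).symm z) = z := by
  have ht := (isOpen_extChartAt_target (I := 𝓡 N) x).mem_nhds (extChartAt_mem_target hy)
  have hc : Filter.Tendsto (extChartAt (𝓡 N) x).symm (𝓝 (extChartAt (𝓡 N) x y)) (𝓝 y) := by
    have h := continuousAt_extChartAt_symm' (I := 𝓡 N) (x := x) (x' := y)
      (by rwa [extChartAt_source])
    rwa [ContinuousAt, (extChartAt (𝓡 N) x).left_inv (by rwa [extChartAt_source])] at h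
  filter_upwards [ht, hc.eventually hp] with z hz hpz
  refine ⟨hpz, ?_, (extChartAt (𝓡 N) x).right_inv hz⟩
  have h := (extChartAt (𝓡 N) x).map_target hz
  rwa [extChartAt_source] at h

theorem eventuallyEq_inChart {x y : M} (hy : y ∈ chartDom (N := N) x) (g : M → W) :
    g =ᶠ[𝓝 y] fun z => inChart x g (extChartAt (𝓡 N) x z) := by
  filter_upwards [(isOpen_chartDom x).mem_nhds hy] with z hz
  exact (inChart_apply hz g).symm

variable [NormedAddCommGroup W] [NormedSpace ℝ W]

theorem contDiffAt_inChart {x y : M} (hy : y ∈ chartDom (N := N) x) {g : M → W}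
    (hg : ContMDiffAt (𝓡 N) 𝓘(ℝ, W) ∞ g y) :
    ContDiffAt ℝ ∞ (inChart x g) (extChartAt (𝓡 N) x y) := by
  rw [← contMDiffAt_iff_contDiffAt]
  have h1 : ContMDiffAt 𝓘(ℝ, Eu N) (𝓡 N) ∞ (extChartAt (𝓡 N) x).symm (extChartAt (𝓡 N) x y) :=
    (contMDiffOn_extChartAt_symm x).contMDiffAt
      ((isOpen_extChartAt_target x).mem_nhds (extChartAt_mem_target hy))
  refine ContMDiffAt.comp (extChartAt (𝓡 N) x y) ?_ h1
  rwa [(extChartAt (𝓡 N) x).left_inv (by rwa [extChartAt_source])]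

theorem contMDiffAt_of_inChart {x y : M} (hy : y ∈ chartDom (N := N) x) {g : M → W}
    (hg : ContDiffAt ℝ ∞ (inChart x g) (extChartAt (𝓡 N) x y)) :
    ContMDiffAt (𝓡 N) 𝓘(ℝ, W) ∞ g y :=
  (hg.contMDiffAt.comp y (contMDiffAt_extChartAt' hy)).congr_of_eventuallyEq
    (eventuallyEq_inChart hy g)

theorem mvfderiv_chartFrame {x y : M} (hy : y ∈ chartDom (N := N) x) {g : M → W}
    (hg : ContMDiffAt (𝓡 N) 𝓘(ℝ, W) ∞ g y) (v : Eu N) :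
    mvfderiv (𝓡 N) g y (chartFrame x y v) =
      fderiv ℝ (inChart x g) (extChartAt (𝓡 N) x y) v := by
  have h1 : MDifferentiableAt (𝓡 N) 𝓘(ℝ, Eu N) (extChartAt (𝓡 N) x) y :=
    mdifferentiableAt_extChartAt hy
  rw [mvfderiv_congr (eventuallyEq_inChart hy g), mvfderiv_hasFDerivAt_comp
    ((contDiffAt_inChart hy hg).differentiableAt (by simp)).hasFDerivAt h1]
  have h2 : mvfderiv (𝓡 N) (extChartAt (𝓡 N) x) y (chartFrame x y v) = v := by
    refine (congrArg (fun L : TangentSpace (𝓡 N) y →L[ℝ] Eu N => L (chartFrame x y v))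
      (mfderiv_extChartAt hy)).trans ?_
    exact (chartFrame x y).symm_apply_apply v
  rw [ContinuousLinearMap.comp_apply, h2]

end

theorem smoothForm_iff {k : ℕ} {β : ∀ x : M, TForm (N := N) k x} : SmoothForm β ↔
    ∀ x : M, ∀ y ∈ chartDom (N := N) x,
      ContMDiffAt (𝓡 N) 𝓘(ℝ, VForm N k) ∞ (fun z => (chartFrame x z).pull (β z)) y :=
  ⟨fun h _ y hy => (contMDiffAt_form_iff (smoothFramesAt_chartFrame hy)).1 (h y),
    fun h y => (contMDiffAt_form_iff (smoothFramesAt_chartFrame (mem_chartDom y))).2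
      (h y y (mem_chartDom y))⟩

theorem smoothFramesOn_chartFrame (x : M) :
    SmoothFramesOn (chartFrame (N := N) x) (chartDom (N := N) x) := fun w _ hy =>
  (smoothFramesAt_chartFrame hy w).contMDiffWithinAt

/-- The covariant exterior derivative in a chart. -/
theorem pull_covExtDeriv_chart
    {cov : CovariantDerivative (𝓡 N) (Eu N) (TangentSpace (𝓡 N) : M → Type _)}
    (hcov : cov.torsion = 0) {k : ℕ} {β : ∀ x : M, TForm (N := N) k x} (hβ : SmoothForm β)
    {x y : M} (hy : y ∈ chartDom (N := N) x) :
    (chartFrame x y).pull (covExtDeriv cov β y) =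
      flatD (inChart x (frameConn cov (chartFrame x)))
        (inChart x fun z => (chartFrame x z).pull (β z)) (extChartAt (𝓡 N) x y) := by
  have hb := smoothForm_iff.1 hβ x y hy
  rw [pull_covExtDeriv hcov (smoothFramesAt_chartFrame hy) hb, flatD, inChart_apply hy,
    inChart_apply hy, frameDeriv, ContinuousAlternatingMap.alternatizeUncurryFin_add,
    ContinuousAlternatingMap.alternatizeUncurryFin_add,
    alternatize_act_of_symmetric (E := Eu N) _ (frameConn_chartFrame_symm hcov hy)]
  congr 2
  ext1 v
  exact mvfderiv_chartFrame hy hb v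

/-- An equality of germs, as needed to differentiate a second time. -/
theorem inChart_pull_covExtDeriv
    {cov : CovariantDerivative (𝓡 N) (Eu N) (TangentSpace (𝓡 N) : M → Type _)}
    (hcov : cov.torsion = 0) {k : ℕ} {β : ∀ x : M, TForm (N := N) k x} (hβ : SmoothForm β)
    {x y : M} (hy : y ∈ chartDom (N := N) x) :
    (inChart x fun z => (chartFrame x z).pull (covExtDeriv cov β z)) =ᶠ[𝓝 (extChartAt (𝓡 N) x y)]
      flatD (inChart x (frameConn cov (chartFrame x)))
        (inChart x fun z => (chartFrame x z).pull (β z)) := by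
  filter_upwards [eventually_inChart hy (p := fun _ => True) (by simp)] with z hz
  rw [inChart, pull_covExtDeriv_chart hcov hβ hz.2.1, hz.2.2]

theorem contDiffAt_frameConn [T2Space M]
    {cov : CovariantDerivative (𝓡 N) (Eu N) (TangentSpace (𝓡 N) : M → Type _)}
    (hcov : cov.ContMDiffCovariantDerivative ∞) {x y : M} (hy : y ∈ chartDom (N := N) x) :
    ContDiffAt ℝ ∞ (inChart x (frameConn cov (chartFrame x))) (extChartAt (𝓡 N) x y) :=
  contDiffAt_inChart (W := Eu N →L[ℝ] Eu N →L[ℝ] Eu N) hy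
    (contMDiffAt_frameConn hcov (isOpen_chartDom x) (smoothFramesOn_chartFrame x) hy)

/-- `covExtDeriv` uses a different chart at each point; frame independence rewrites it throughout
one chart domain as `flatD`, which is visibly smooth. -/
theorem smoothForm_covExtDeriv [T2Space M]
    {cov : CovariantDerivative (𝓡 N) (Eu N) (TangentSpace (𝓡 N) : M → Type _)}
    (hcov : cov.ContMDiffCovariantDerivative ∞) (htor : cov.torsion = 0)
    {k : ℕ} {β : ∀ x : M, TForm (N := N) k x} (hβ : SmoothForm β) :
    SmoothForm (covExtDeriv cov β) := by
  refine smoothForm_iff.2 fun x y hy => contMDiffAt_of_inChart hy ?_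
  exact (contDiffAt_flatD (contDiffAt_frameConn hcov hy)
    (contDiffAt_inChart hy (smoothForm_iff.1 hβ x y hy))).congr_of_eventuallyEq
    (inChart_pull_covExtDeriv htor hβ hy)

theorem pull_covExtDeriv_covExtDeriv [T2Space M]
    {cov : CovariantDerivative (𝓡 N) (Eu N) (TangentSpace (𝓡 N) : M → Type _)}
    (hcov : cov.ContMDiffCovariantDerivative ∞) (htor : cov.torsion = 0)
    {k : ℕ} {β : ∀ x : M, TForm (N := N) k x} (hβ : SmoothForm β)
    {x y : M} (hy : y ∈ chartDom (N := N) x) :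
    (chartFrame x y).pull (covExtDeriv cov (covExtDeriv cov β) y) =
      flatD (inChart x (frameConn cov (chartFrame x)))
        (flatD (inChart x (frameConn cov (chartFrame x)))
          (inChart x fun z => (chartFrame x z).pull (β z))) (extChartAt (𝓡 N) x y) := by
  rw [pull_covExtDeriv_chart htor (smoothForm_covExtDeriv hcov htor hβ) hy]
  exact flatD_congr _ (inChart_pull_covExtDeriv htor hβ hy)

end

section

theorem act_sub {E : Type*} [NormedAddCommGroup E] [NormedSpace ℝ E] {k : ℕ}
    (b b' : E [⋀^Fin k]→L[ℝ] E) (A : E →L[ℝ] E) : act (b - b') A = act b A - act b' A := by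
  rw [map_sub]
  rfl

variable {N : ℕ} {M : Type*} [TopologicalSpace M] [ChartedSpace (Eu N) M]
  [IsManifold (𝓡 N) ∞ M] {G : Subgroup (Eu N ≃ₗᵢ[ℝ] Eu N)}

/-! ### Associated bundles -/

theorem GStructure.exists_frameChange_eq (Q : GStructure G M) {x : M} {u u' : Frame (N := N) x}
    (hu : u ∈ Q.frames x) (hu' : u' ∈ Q.frames x) :
    ∃ g ∈ G, frameChange u u' = isoCLM g ∧ frameChange u' u = isoCLM g⁻¹ := by
  obtain ⟨g, hg, h⟩ := (Q.orbit x u hu u').1 hu'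
  refine ⟨g, hg, ?_, ?_⟩
  · ext1 w
    rw [frameChange_apply, h, u.symm_apply_apply]
    rfl
  · ext1 w
    rw [frameChange_apply, ContinuousLinearEquiv.symm_apply_eq, h]
    exact congrArg u (g.apply_symm_apply w).symm

/-- Adapted frames differ by elements of `G`, which preserve `𝔤^k`, so any one of them tests
membership. -/
theorem GStructure.mem_gHat_iff (Q : GStructure G M) {x : M} {u : Frame (N := N) x}
    (hu : u ∈ Q.frames x) {k : ℕ} {b : TForm (N := N) k x} :
    b ∈ Q.gHat k x ↔ u.pull b ∈ gPow G k := by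
  constructor
  · rintro ⟨u', hu', a, ha, rfl⟩
    obtain ⟨g, hg, h1, h2⟩ := Q.exists_frameChange_eq hu hu'
    rw [pull_eq_transport u u', Frame.pull_push, h1, h2]
    exact transport_mem_gPow hg ha
  · exact fun h => ⟨u, hu, _, h, (u.push_pull b).symm⟩

theorem GStructure.mem_pHat_iff (Q : GStructure G M) {x : M} {u : Frame (N := N) x}
    (hu : u ∈ Q.frames x) {k : ℕ} {b : TForm (N := N) k x} :
    b ∈ Q.pHat k x ↔ u.pull b ∈ pPow G k := by
  constructor
  · rintro ⟨u', hu', a, ha, rfl⟩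
    obtain ⟨g, hg, h1, h2⟩ := Q.exists_frameChange_eq hu hu'
    rw [pull_eq_transport u u', Frame.pull_push, h1, h2]
    exact transport_mem_pPow hg ha
  · exact fun h => ⟨u, hu, _, h, (u.push_pull b).symm⟩

theorem GStructure.pull_pr (Q : GStructure G M) {x : M} {u : Frame (N := N) x}
    (hu : u ∈ Q.frames x) {k : ℕ} (b : TForm (N := N) k x) :
    u.pull (Q.pr x b) = prP G k (u.pull b) := by
  obtain ⟨g, hg, h1, h2⟩ := Q.exists_frameChange_eq hu (Q.nonempty x).some_mem
  rw [GStructure.pr, pull_eq_transport u (Q.nonempty x).some, Frame.pull_push, h1, h2,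
    ← prP_transport hg, ← h1, ← h2, ← pull_eq_transport]

theorem GStructure.pr_mem_pHat (Q : GStructure G M) {x : M} {k : ℕ} (b : TForm (N := N) k x) :
    Q.pr x b ∈ Q.pHat k x := by
  obtain ⟨u, hu⟩ := Q.nonempty x
  rw [Q.mem_pHat_iff hu, Q.pull_pr hu]
  exact (prP_eq_iff.1 rfl).1

theorem GStructure.sub_pr_mem_gHat (Q : GStructure G M) {x : M} {k : ℕ} (b : TForm (N := N) k x) :
    b - Q.pr x b ∈ Q.gHat k x := by
  obtain ⟨u, hu⟩ := Q.nonempty x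
  rw [Q.mem_gHat_iff hu, Frame.pull_sub, Q.pull_pr hu]
  exact (prP_eq_iff.1 rfl).2

theorem GStructure.pr_eq_zero (Q : GStructure G M) {x : M} {k : ℕ} {b : TForm (N := N) k x}
    (hb : b ∈ Q.gHat k x) : Q.pr x b = 0 := by
  obtain ⟨u, hu⟩ := Q.nonempty x
  have h : u.pull (Q.pr x b) = 0 := by
    rw [Q.pull_pr hu]
    exact prP_eq_iff.2 ⟨zero_mem _, by simpa using (Q.mem_gHat_iff hu).1 hb⟩
  rw [← u.push_pull (Q.pr x b), h]
  ext1 v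
  exact map_zero u

/-- In a smooth adapted frame the projection is the constant linear map `prP`. -/
theorem GStructure.smoothForm_pr (Q : GStructure G M) {k : ℕ} {β : ∀ x : M, TForm (N := N) k x}
    (hβ : SmoothForm β) : SmoothForm fun x => Q.pr x (β x) := by
  intro x
  obtain ⟨U, hU, hxU, s, hsQ, hs⟩ := Q.smooth x
  have hsx := hs.smoothFramesAt hU hxU
  refine (contMDiffAt_form_iff hsx).2 ?_
  have h1 := (contMDiffAt_form_iff hsx).1 (hβ x)
  have h2 := (LinearMap.toContinuousLinearMap (prP G k)).contMDiff.contMDiffAt.comp x h1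
  refine h2.congr_of_eventuallyEq ?_
  filter_upwards [hU.mem_nhds hxU] with z hz
  exact Q.pull_pr (hsQ z hz) _

theorem smoothForm_sub {k : ℕ} {β γ : ∀ x : M, TForm (N := N) k x} (hβ : SmoothForm β)
    (hγ : SmoothForm γ) : SmoothForm fun x => β x - γ x := by
  refine smoothForm_iff.2 fun x y hy => ?_
  rw [funext fun z => Frame.pull_sub (chartFrame x z) (β z) (γ z)]
  exact (smoothForm_iff.1 hβ x y hy).sub (smoothForm_iff.1 hγ x y hy)

theorem covExtDeriv_sub {cov : CovariantDerivative (𝓡 N) (Eu N) (TangentSpace (𝓡 N) : M → Type _)}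
    (htor : cov.torsion = 0) {k : ℕ} {β γ : ∀ x : M, TForm (N := N) k x} (hβ : SmoothForm β)
    (hγ : SmoothForm γ) (x : M) :
    covExtDeriv cov (fun x => β x - γ x) x = covExtDeriv cov β x - covExtDeriv cov γ x := by
  have hc := smoothFramesAt_chartFrame (mem_chartDom (N := N) x)
  have h1 := smoothForm_iff.1 hβ x x (mem_chartDom x)
  have h2 := smoothForm_iff.1 hγ x x (mem_chartDom x)
  have h3 := smoothForm_iff.1 (smoothForm_sub hβ hγ) x x (mem_chartDom x)
  rw [← (chartFrame x x).push_pull (covExtDeriv cov (fun x => β x - γ x) x),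
    ← (chartFrame x x).push_pull (covExtDeriv cov β x - covExtDeriv cov γ x), Frame.pull_sub,
    pull_covExtDeriv htor hc h1, pull_covExtDeriv htor hc h2, pull_covExtDeriv htor hc h3]
  have h4 : frameDeriv cov (chartFrame x) (fun x => β x - γ x) x +
      frameDeriv cov (chartFrame x) γ x = frameDeriv cov (chartFrame x) β x := by
    ext1 v
    change frameDeriv cov (chartFrame x) (fun x => β x - γ x) x v +
      frameDeriv cov (chartFrame x) γ x v = frameDeriv cov (chartFrame x) β x v
    have h5 : mvfderiv (𝓡 N) (fun z => (chartFrame x z).pull (β z - γ z)) x (chartFrame x x v) =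
        mvfderiv (𝓡 N) (fun z => (chartFrame x z).pull (β z)) x (chartFrame x x v) -
        mvfderiv (𝓡 N) (fun z => (chartFrame x z).pull (γ z)) x (chartFrame x x v) := by
      rw [funext fun z => Frame.pull_sub (chartFrame x z) (β z) (γ z),
        mvfderiv_fun_sub (h1.mdifferentiableAt (by simp)) (h2.mdifferentiableAt (by simp))]
      rfl
    rw [frameDeriv_apply, frameDeriv_apply, frameDeriv_apply, h5, Frame.pull_sub]
    rw [act_sub (E := Eu N)]
    abel
  rw [← h4, ContinuousAlternatingMap.alternatizeUncurryFin_add, add_sub_cancel_right]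

/-! ### The complex -/

theorem GStructure.IsConnection.frameConn_mem {Q : GStructure G M}
    {cov : CovariantDerivative (𝓡 N) (Eu N) (TangentSpace (𝓡 N) : M → Type _)}
    (hQ : Q.IsConnection cov) {U : Set M} (hU : IsOpen U) {s : ∀ y : M, Frame (N := N) y}
    (hsQ : ∀ y ∈ U, s y ∈ Q.frames y) (hs : SmoothFramesOn s U) {y : M} (hy : y ∈ U) (v : Eu N) :
    frameConn cov s y v ∈ lieAlg G := by
  obtain ⟨A, hA, h⟩ := hQ U s hU hsQ hs y hy (s y v)
  have h1 : frameConn cov s y v = A := by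
    ext1 w
    refine (s y).injective ?_
    rw [← cov_frame cov (hs.smoothFramesAt hU hy), h]
  rwa [h1]

/-- The covariant exterior derivative preserves the sections of the bundles `𝔤^k`. -/
theorem GStructure.IsConnection.covExtDeriv_mem_gHat {Q : GStructure G M}
    {cov : CovariantDerivative (𝓡 N) (Eu N) (TangentSpace (𝓡 N) : M → Type _)}
    (hQ : Q.IsConnection cov) (htor : cov.torsion = 0) {k : ℕ} {β : ∀ x : M, TForm (N := N) k x}
    (hβ : SmoothForm β) (hβQ : ∀ x, β x ∈ Q.gHat k x) (x : M) :
    covExtDeriv cov β x ∈ Q.gHat (k + 1) x := by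
  obtain ⟨U, hU, hxU, s, hsQ, hs⟩ := Q.smooth x
  have hsx := hs.smoothFramesAt hU hxU
  have hb := (contMDiffAt_form_iff hsx).1 (hβ x)
  rw [Q.mem_gHat_iff (hsQ x hxU), pull_covExtDeriv htor hsx hb]
  refine alternatize_mem_gPow fun v => ?_
  rw [frameDeriv_apply]
  refine add_mem ?_ (act_mem_gPow (hQ.frameConn_mem hU hsQ hs hxU v)
    ((Q.mem_gHat_iff (hsQ x hxU)).1 (hβQ x)))
  -- The remaining term is the derivative of coordinates that lie in `𝔤^k` throughout `U`, the frame
  -- being adapted there.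
  obtain ⟨P, hP⟩ := exists_clm_mem_iff (gPow G k)
  have h1 := mvfderiv_hasFDerivAt_comp P.hasFDerivAt (hb.mdifferentiableAt (by simp))
  have h2 : mvfderiv (𝓡 N) (fun z => P ((s z).pull (β z))) x = 0 := by
    rw [mvfderiv_congr (g' := fun _ => (0 : VForm N k)), mvfderiv_const]
    filter_upwards [hU.mem_nhds hxU] with z hz
    exact (hP _).1 ((Q.mem_gHat_iff (hsQ z hz)).1 (hβQ z))
  rw [hP, ← ContinuousLinearMap.comp_apply, ← h1, h2]
  rfl

/-- The square of the covariant exterior derivative of a torsion-free connection on `Q` takes its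
values in the bundles `𝔤^k`. -/
theorem GStructure.IsConnection.covExtDeriv_covExtDeriv_mem_gHat [T2Space M] {Q : GStructure G M}
    {cov : CovariantDerivative (𝓡 N) (Eu N) (TangentSpace (𝓡 N) : M → Type _)}
    (hQ : Q.IsConnection cov) (hcov : cov.ContMDiffCovariantDerivative ∞) (htor : cov.torsion = 0)
    {k : ℕ} {β : ∀ x : M, TForm (N := N) k x} (hβ : SmoothForm β) (x : M) :
    covExtDeriv cov (covExtDeriv cov β) x ∈ Q.gHat (k + 2) x := by
  obtain ⟨U, hU, hxU, s, hsQ, hs⟩ := Q.smooth x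
  have hx := mem_chartDom (N := N) x
  have hsx := hs.smoothFramesAt hU hxU
  have hcx := smoothFramesAt_chartFrame hx
  let φ := extChartAt (𝓡 N) x
  let Γ := inChart (N := N) x (frameConn cov (chartFrame x))
  let b := inChart (N := N) x fun z => (chartFrame x z).pull (β z)
  let e := inChart (N := N) x fun z => frameChange (chartFrame x z) (s z)
  -- Connection form of the adapted frame, its direction argument converted to chart coordinates so
  -- that it can be compared with `Γ`.
  let A := inChart (N := N) x fun z => frameConn cov s z ∘L frameChange (s z) (chartFrame x z)
  have hΓ : ContDiffAt ℝ ∞ Γ (φ x) := contDiffAt_frameConn hcov hx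
  have hb : ContDiffAt ℝ ∞ b (φ x) := contDiffAt_inChart hx (smoothForm_iff.1 hβ x x hx)
  have he : ContDiffAt ℝ ∞ e (φ x) := contDiffAt_inChart hx (contMDiffAt_frameChange hcx hsx)
  have hA : ContDiffAt ℝ ∞ A (φ x) := contDiffAt_inChart (W := Eu N →L[ℝ] Eu N →L[ℝ] Eu N) hx
    ((contMDiffAt_frameConn hcov hU hs hxU).clm_comp (contMDiffAt_frameChange hsx hcx))
  have hex : e (φ x) = frameChange (chartFrame x x) (s x) := inChart_apply hx _
  have hbx : b (φ x) = (chartFrame x x).pull (β x) := inChart_apply hx _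
  have hnear := eventually_inChart hx (hU.mem_nhds hxU)
  obtain ⟨R, hR, hRR⟩ := exists_flatD_flatD (E := Eu N) hΓ hb
  have hcurv := frame_curvature (E := Eu N) he (hΓ.differentiableAt (by simp))
    (hA.differentiableAt (by simp)) (by
      filter_upwards [hnear] with z hz v
      have h := mvfderiv_frameChange cov (smoothFramesAt_chartFrame hz.2.1)
        (hs.smoothFramesAt hU hz.1) v
      rw [mvfderiv_chartFrame hz.2.1 (contMDiffAt_frameChange (smoothFramesAt_chartFrame hz.2.1)
        (hs.smoothFramesAt hU hz.1)), hz.2.2] at h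
      exact h)
  have hAmem : ∀ᶠ z in 𝓝 (φ x), ∀ v, A z v ∈ lieAlg G := by
    filter_upwards [hnear] with z hz v
    exact hQ.frameConn_mem hU hsQ hs hz.1 _
  have hA' : ∀ v w, fderiv ℝ A (φ x) v w ∈ lieAlg G := by
    intro v w
    have h := (hA.differentiableAt (by simp)).hasFDerivAt.clm_apply (hasFDerivAt_const w (φ x))
    have h1 := hasFDerivAt_mem_submodule h (hAmem.mono fun z hz => hz w) v
    simpa using h1
  have hfe : frameChange (s x) (chartFrame x x) ∘L e (φ x) = ContinuousLinearMap.id ℝ (Eu N) := by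
    rw [hex, frameChange_comp, frameChange_self]
  have hef : e (φ x) ∘L frameChange (s x) (chartFrame x x) = ContinuousLinearMap.id ℝ (Eu N) := by
    rw [hex, frameChange_comp, frameChange_self]
  have hRmem : ∀ v w, frameChange (s x) (chartFrame x x) ∘L R v w ∘L e (φ x) ∈ lieAlg G := by
    intro v w
    -- Conjugated into the adapted frame, the curvature is that of `A`; its derivative and bracket
    -- terms both lie in the Lie algebra.
    rw [hR, ← hcurv, ← ContinuousLinearMap.comp_assoc, hfe, ContinuousLinearMap.id_comp]
    exact add_mem (sub_mem (hA' v w) (hA' w v))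
      (bracket_mem_lieAlg (hAmem.self_of_nhds v) (hAmem.self_of_nhds w))
  have hB := bianchi_of_symmetric (E := Eu N) (hΓ.differentiableAt (by simp)) (by
    filter_upwards [hnear] with z hz v w
    exact frameConn_chartFrame_symm htor hz.2.1 v w) hR
  obtain ⟨R', hR', htr⟩ := exists_transport_alt₂ (E := Eu N) hef R
  have hmem : alt₂ (ContinuousLinearMap.postcomp (Eu N) (postcomp
      (transport (frameChange (s x) (chartFrame x x)) (e (φ x)) (b (φ x)))) ∘L R') ∈
      gPow G (k + 2) := by
    refine alt₂_postcomp_mem_gPow _ (fun v w => ?_) (fun v w => ?_) fun u v w => ?_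
    · rw [hR']
      exact hRmem _ _
    · rw [hR', hR', hR, hR]
      ext1 u
      simp only [ContinuousLinearMap.comp_apply, neg_apply, add_apply, sub_apply, map_add, map_sub]
      abel
    · rw [hR', hR', hR']
      simp only [ContinuousLinearMap.comp_apply]
      rw [← map_add, ← map_add, hB, map_zero]
  -- Membership is known for twice the square, and the factor two is removed by scaling.
  rw [← htr, ← hRR, map_add, ← two_smul ℝ,
    Submodule.smul_mem_iff _ (two_ne_zero : (2 : ℝ) ≠ 0)] at hmem
  rw [Q.mem_gHat_iff (hsQ x hxU), pull_eq_transport (s x) (chartFrame x x),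
    pull_covExtDeriv_covExtDeriv hcov htor hβ hx, ← hex]
  exact hmem

/-- Discarding the `𝔤^{k+1}` part of the first derivative costs nothing: its own derivative stays in
the next `𝔤` bundle, which the second projection annihilates. -/
theorem GStructure.dQ_dQ [T2Space M] (Q : GStructure G M)
    {cov : CovariantDerivative (𝓡 N) (Eu N) (TangentSpace (𝓡 N) : M → Type _)}
    (hQ : Q.IsConnection cov) (hcov : cov.ContMDiffCovariantDerivative ∞) (htor : cov.torsion = 0)
    {k : ℕ} {β : ∀ x : M, TForm (N := N) k x} (hβ : SmoothForm β) :
    Q.dQ cov (Q.dQ cov β) = 0 := by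
  have hd := smoothForm_covExtDeriv hcov htor hβ
  have hp := Q.smoothForm_pr hd
  have hθ := hQ.covExtDeriv_mem_gHat htor (smoothForm_sub hd hp) fun y => Q.sub_pr_mem_gHat _
  funext x
  refine Q.pr_eq_zero ?_
  obtain ⟨u, hu⟩ := Q.nonempty x
  have h1 := (Q.mem_gHat_iff hu).1 (hθ x)
  have h2 := (Q.mem_gHat_iff hu).1 (hQ.covExtDeriv_covExtDeriv_mem_gHat hcov htor hβ x)
  rw [covExtDeriv_sub htor hd hp, Frame.pull_sub] at h1
  rw [Q.mem_gHat_iff hu]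
  have h3 := sub_mem h2 h1
  rwa [sub_sub_cancel] at h3

end

end GStr

end

theorem proposition4p1 {N : ℕ} {M : Type*} [TopologicalSpace M]
    [ChartedSpace (EuclideanSpace ℝ (Fin N)) M] [IsManifold (𝓡 N) ∞ M] [T2Space M]
    (G : Subgroup (EuclideanSpace ℝ (Fin N) ≃ₗᵢ[ℝ] EuclideanSpace ℝ (Fin N)))
    (Q : GStr.GStructure G M) (hQ : Q.IsTorsionFree)
    (cov : CovariantDerivative (𝓡 N) (EuclideanSpace ℝ (Fin N)) (TangentSpace (𝓡 N) : M → Type _))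
    (hcov : GStr.IsLeviCivita Q.metric cov) :
    (∀ (k : ℕ) (β : ∀ x : M, GStr.TForm (N := N) k x), GStr.SmoothForm β →
      GStr.covExtDeriv cov (GStr.covExtDeriv cov β) ∈ GStr.smoothSections (Q.gHat (k + 2))) ∧
    (∀ (k : ℕ), ∀ β ∈ GStr.smoothSections (Q.pHat k),
      Q.dQ cov β ∈ GStr.smoothSections (Q.pHat (k + 1)) ∧ Q.dQ cov (Q.dQ cov β) = 0) := by
  have hconn := hQ cov hcov
  refine ⟨fun k β hβ => ⟨GStr.smoothForm_covExtDeriv hcov.smooth hcov.torsion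
    (GStr.smoothForm_covExtDeriv hcov.smooth hcov.torsion hβ),
    hconn.covExtDeriv_covExtDeriv_mem_gHat hcov.smooth hcov.torsion hβ⟩,
    fun k β hβ => ⟨⟨Q.smoothForm_pr (GStr.smoothForm_covExtDeriv hcov.smooth hcov.torsion hβ.1),
      fun x => Q.pr_mem_pHat _⟩, Q.dQ_dQ hconn hcov.smooth hcov.torsion hβ.1⟩⟩
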